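/- Let $X=(X_t)_{t\ge0}$, $X_0=0$, be a real Lévy process with triplet $(\gamma,\sigma^2,\Pi_X)$ (truncation function $\mathbf 1_{\{|x|<1\}}$). **Definitions.** - $X$ is in the *Cramér case* with parameter $\nu_0>0$ if $E e^{\nu_0X_1}=1$ and $E X_1e^{\nu_0X_1}<\infty$. - For a probability distribution $F$ on $[0,\infty)$ with tail $\overline F(u)=F((u,\infty))$ and $\alpha>0$, write $F\in\mathcal L^{(\alpha)}$ if $\overline F(u-x)/\overline F(u)\to e^{\alpha x}$ as $u\to\infty$ for every $x\in\mathbb R$. Write $F\in\mathcal S^{(\alpha)}$ if $F\in\mathcal L^{(\alpha)}$ and $\overline{F*F}(x)/\overline F(x)\to 2\int e^{\alpha y}F(dy)<\infty$ as $x\to\infty$. Write $\overline\Pi_X^+\in\mathcal S^{(\alpha)}$ if, for some $x_0>0$ with $\Pi_X((x_0,\infty))>0$, the normalised measure $\Pi_X(\cdot\cap(x_0,\infty))/\Pi_X((x_0,\infty))$ is in $\mathcal S^{(\alpha)}$. - $X$ is in the *convolution equivalent case* with index $\alpha>0$ if $\Pi_X((0,\infty))>0$, $\overline\Pi_X^+\in\mathcal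 S^{(\alpha)}$ and $E e^{\alpha X_1}<1$. - $X$ is a *GTSC process* with parameters $q>0$, ${\rm d}_H\ge0$, $c>0$, $\alpha\ge0$, $\rho\in[-1,1)$ (with $\alpha>0$ if $\rho\le0$) if, for all $\theta<\alpha$, $E e^{\theta X_1}<\infty$ and $\psi_X(\theta)=\log E e^{\theta X_1}$ equals $$-q\theta+{\rm d}_H\theta^2-c\theta\Gamma(-\rho)\bigl(\alpha^\rho-(\alpha-\theta)^\rho\bigr)\quad(\rho\ne0),\qquad -q\theta+{\rm d}_H\theta^2+c\theta\log\frac{\alpha}{\alpha-\theta}\quad(\rho=0).$$ **Theorem.** Let $X$ be a GTSC process with parameters $(q,{\rm d}_H,c,\alpha,\rho)$ and $\alpha>0$. (i) If $\rho\in[-1,0]$, or if $\rho\in(0,1)$ and ${\rm d}_H\alpha-q-c\alpha^\rho\Gamma(-\rho)>0$, then $\psi_X$ has a unique root $\nu_0$ in $(0,\alpha)$ and $X$ is in the Cramér case with parameter $\nu_0$. Moreover ${\rm d}_H\nu_0-q-c\Gamma(-\rho)(\alpha^\rho-(\alpha-\nu_0)^\rho)=0$ if $\rho\ne0$, and ${\rm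 d}_H\nu_0-q+c\log\frac{\alpha}{\alpha-\nu_0}=0$ if $\rho=0$. (ii) If $\rho\in(0,1)$ and ${\rm d}_H\alpha-q-c\alpha^\rho\Gamma(-\rho)<0$, then $X$ is in the convolution equivalent case with index $\alpha$. (iii) If $\rho\in(0,1)$ and ${\rm d}_H\alpha-q-c\alpha^\rho\Gamma(-\rho)=0$, then $X$ is in neither case: there is no $\nu_0>0$ for which it is in the Cramér case with parameter $\nu_0$, and no $\alpha'>0$ for which it is in the convolution equivalent case with index $\alpha'$. -/

import Mathlib

open MeasureTheory ProbabilityTheory Filter Set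
open scoped Topology NNReal

noncomputable section

/-- A real-valued Lévy process `(X_t)_{t ≥ 0}` on a probability space, started at `0`:
independent and stationary increments, almost surely càdlàg paths. -/
structure IsLevyProcess {Ω : Type*} [MeasurableSpace Ω] (X : ℝ≥0 → Ω → ℝ) (P : Measure Ω) :
    Prop where
  isProbabilityMeasure : IsProbabilityMeasure P
  measurable : ∀ t, Measurable (X t)
  zero : ∀ᵐ ω ∂P, X 0 ω = 0
  indep : HasIndepIncrements X P
  stationary : ∀ s t, IdentDistrib (fun ω => X (s + t) ω - X s ω) (X t) P P
  cadlag : ∀ᵐ ω ∂P, ∀ t,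
    ContinuousWithinAt (fun s => X s ω) (Ioi t) t ∧
      ∃ l : ℝ, Tendsto (fun s => X s ω) (𝓝[<] t) (𝓝 l)

/-- A Lévy measure on `ℝ`: no mass at `0`, and `∫ min(1, x²) Π(dx) < ∞`. -/
structure IsLevyMeasure (ν : Measure ℝ) : Prop where
  zero : ν {0} = 0
  integrable : ∫⁻ x, ENNReal.ofReal (min 1 (x ^ 2)) ∂ν < ⊤

/-- The Lévy–Khintchine exponent
`Ψ(θ) = iθγ - σ²θ²/2 + ∫ (e^{iθx} - 1 - iθx 1_{|x| < 1}) Π(dx)`; `s` stands for `σ²`. -/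
def levyKhintchineExponent (γ s : ℝ) (ν : Measure ℝ) (θ : ℝ) : ℂ :=
  Complex.I * θ * γ - s * θ ^ 2 / 2 +
    ∫ x : ℝ, (Complex.exp (Complex.I * θ * x) - 1 -
      Complex.I * θ * (if |x| < 1 then (x : ℂ) else 0)) ∂ν

/-- `(γ, s, ν)` is the Lévy triplet of the Lévy process `X`, i.e. the generating triplet of the
(infinitely divisible) law of `X_1`. -/
structure HasLevyTriplet {Ω : Type*} [MeasurableSpace Ω] (X : ℝ≥0 → Ω → ℝ) (P : Measure Ω)
    (γ s : ℝ) (ν : Measure ℝ) : Prop where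
  nonneg : 0 ≤ s
  levyMeasure : IsLevyMeasure ν
  charFun_eq : ∀ θ : ℝ,
    ∫ ω, Complex.exp (Complex.I * θ * X 1 ω) ∂P = Complex.exp (levyKhintchineExponent γ s ν θ)

/-- The class `L^(α)` of distributions `F` on `[0, ∞)`: with `F̄(u) = F(u, ∞)`,
`F̄(u - x) / F̄(u) → e^{αx}` as `u → ∞`, for every real `x`. -/
structure IsLongTailed (α : ℝ) (F : Measure ℝ) : Prop where
  isProbabilityMeasure : IsProbabilityMeasure F
  nonneg : F (Iio 0) = 0
  tendsto : ∀ x : ℝ,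
    Tendsto (fun u : ℝ => F.real (Ioi (u - x)) / F.real (Ioi u)) atTop (𝓝 (Real.exp (α * x)))

/-- The class `S^(α)` of convolution equivalent distributions on `[0, ∞)`: `F ∈ L^(α)` and the
tail of `F * F` divided by the tail of `F` tends to `2 δ_α(F)`, where the moment generating
function `δ_α(F) = ∫ e^{αx} F(dx)` is finite. -/
structure IsConvolutionEquivalent (α : ℝ) (F : Measure ℝ) : Prop where
  longTailed : IsLongTailed α F
  integrable : Integrable (fun x : ℝ => Real.exp (α * x)) F
  tendsto :
    Tendsto (fun x : ℝ => (Measure.conv F F).real (Ioi x) / F.real (Ioi x)) atTop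
      (𝓝 (2 * ∫ x : ℝ, Real.exp (α * x) ∂F))

/-- A Lévy measure has its positive tail in `S^(α)`: for some `x₀ > 0` with `Π(x₀, ∞) > 0`, the
normalised restriction `Π(· ∩ (x₀, ∞)) / Π(x₀, ∞)` is in `S^(α)`. -/
def LevyTailConvolutionEquivalent (α : ℝ) (ν : Measure ℝ) : Prop :=
  ∃ x₀ : ℝ, 0 < x₀ ∧ 0 < ν (Ioi x₀) ∧ IsConvolutionEquivalent α (ProbabilityTheory.cond ν (Ioi x₀))

/-- The Cramér case with parameter `ν₀`: `ν₀ > 0`, `E e^{ν₀ X_1} = 1` and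
`E X_1 e^{ν₀ X_1} < ∞`. The negative part of `X_1 e^{ν₀ X_1}` is bounded, so that the last
expectation is finite exactly when the variable is integrable. -/
structure InCramerCase {Ω : Type*} [MeasurableSpace Ω] (X : ℝ≥0 → Ω → ℝ) (P : Measure Ω)
    (ν₀ : ℝ) : Prop where
  pos : 0 < ν₀
  integrable_exp : Integrable (fun ω => Real.exp (ν₀ * X 1 ω)) P
  expectation_eq_one : ∫ ω, Real.exp (ν₀ * X 1 ω) ∂P = 1
  integrable_mul_exp : Integrable (fun ω => X 1 ω * Real.exp (ν₀ * X 1 ω)) P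

/-- The convolution equivalent case with index `α > 0`: the Lévy measure `Π` of `X` charges
`(0, ∞)`, its positive tail is in `S^(α)`, and `E e^{α X_1} < 1`. -/
structure InConvolutionEquivalentCase {Ω : Type*} [MeasurableSpace Ω] (X : ℝ≥0 → Ω → ℝ)
    (P : Measure Ω) (α : ℝ) : Prop where
  pos : 0 < α
  tail : ∃ (γ s : ℝ) (ν : Measure ℝ), HasLevyTriplet X P γ s ν ∧ 0 < ν (Ioi 0) ∧
    LevyTailConvolutionEquivalent α ν
  integrable_exp : Integrable (fun ω => Real.exp (α * X 1 ω)) P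
  expectation_lt_one : ∫ ω, Real.exp (α * X 1 ω) ∂P < 1

/-- The Laplace exponent of the GTSC process with parameters `(q, d, c, α, ρ)`, for `θ < α`. -/
def gtscExponent (q d c α ρ θ : ℝ) : ℝ :=
  if ρ = 0 then -q * θ + d * θ ^ 2 + c * θ * Real.log (α / (α - θ))
  else -q * θ + d * θ ^ 2 - c * θ * Real.Gamma (-ρ) * (α ^ ρ - (α - θ) ^ ρ)

/-- `X` is a GTSC (Gaussian-Tempered-Stable-Convolution) Lévy process with parameters
`(q, d_H, c, α, ρ)`. Mathlib's `cgf (X 1) P θ` is `log E e^{θ X_1}`, the Laplace exponent of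
`X`. -/
structure IsGTSC {Ω : Type*} [MeasurableSpace Ω] (X : ℝ≥0 → Ω → ℝ) (P : Measure Ω)
    (q d c α ρ : ℝ) : Prop where
  q_pos : 0 < q
  d_nonneg : 0 ≤ d
  c_pos : 0 < c
  alpha_nonneg : 0 ≤ α
  rho_mem : ρ ∈ Ico (-1 : ℝ) 1
  alpha_pos : ρ ≤ 0 → 0 < α
  levy : IsLevyProcess X P
  integrable_exp : ∀ θ < α, Integrable (fun ω => Real.exp (θ * X 1 ω)) P
  cgf_eq : ∀ θ < α, cgf (X 1) P θ = gtscExponent q d c α ρ θ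

end

/-! Write `ψ(θ) = θ · gtscSlope θ`. The slope equals `-q < 0` at `0` and is strictly increasing on
`(-∞, α)`, so everything depends on its behaviour at `α`. For `ρ ≤ 0` it tends to infinity there.
For `0 < ρ < 1` it extends continuously to `α`, and its value there is the quantity whose sign
separates the three cases. If the slope ends up positive, it has exactly one zero in `(0, α)`; this
lies in the interior of the domain of the moment generating function, where all weighted moments are
finite, which gives the Cramér case.

For `0 < ρ < 1`, Fatou's lemma and dominated convergence extend `E e^{θX_1} = e^{θ · gtscSlope θ}`
to `θ = α`, so a negative slope at `α` means `E e^{αX_1} < 1`. The Lévy measure is found by analytic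
continuation of the Laplace exponent to `Re z < α` (`IsGTSC.complexMGF_eq`) and an explicit
computation on the imaginary axis (`integral_temperedDensity_mul`). Its tail is `c e^{-αx}
x^{-1-ρ}`, which is convolution equivalent of index `α`
(`isConvolutionEquivalent_cond_temperedMeasure`).

When the slope vanishes at `α`, `E e^{αX_1} = 1`, but the term `(α - θ)^ρ` gives `ψ` an infinite
left derivative at `α`, so `E X_1 e^{αX_1}` is infinite. This excludes `α` as Cramér parameter; the
negative slope excludes smaller parameters, and a larger one would make the same expectation finite.
Since the Lévy measure is unique (`HasLevyTriplet.measure_unique`), the only possible convolution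
equivalence index is `α`, where the expectation is not below `1`. -/

noncomputable section

/-! ### The slope of the Laplace exponent -/

/-- The quotient `ψ(θ) / θ` of the Laplace exponent of a GTSC process by its argument. -/
def gtscSlope (q d c α ρ θ : ℝ) : ℝ :=
  if ρ = 0 then d * θ - q + c * Real.log (α / (α - θ))
  else d * θ - q - c * Real.Gamma (-ρ) * (α ^ ρ - (α - θ) ^ ρ)

lemma gtscExponent_eq_mul_gtscSlope (q d c α ρ θ : ℝ) :
    gtscExponent q d c α ρ θ = θ * gtscSlope q d c α ρ θ := by
  unfold gtscExponent gtscSlope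
  split_ifs <;> ring

lemma Gamma_one_sub_eq {ρ : ℝ} (hρ : ρ ≠ 0) :
    Real.Gamma (1 - ρ) = -ρ * Real.Gamma (-ρ) := by
  rw [← Real.Gamma_add_one (neg_ne_zero.mpr hρ)]
  ring_nf

lemma Gamma_neg_lt_zero {ρ : ℝ} (hρ : ρ ∈ Ioo (0 : ℝ) 1) : Real.Gamma (-ρ) < 0 := by
  have h := Gamma_one_sub_eq hρ.1.ne'
  have h1 : 0 < Real.Gamma (1 - ρ) := Real.Gamma_pos_of_pos (by linarith [hρ.2])
  have h2 := hρ.1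
  by_contra! h0
  nlinarith

lemma gtscSlope_zero {q d c α ρ : ℝ} (hα : 0 < α) : gtscSlope q d c α ρ 0 = -q := by
  unfold gtscSlope
  split_ifs <;> simp [hα.ne']

lemma gtscSlope_self {q d c α ρ : ℝ} (hρ : ρ ∈ Ioo (0 : ℝ) 1) :
    gtscSlope q d c α ρ α = d * α - q - c * α ^ ρ * Real.Gamma (-ρ) := by
  unfold gtscSlope
  rw [if_neg hρ.1.ne', sub_self, Real.zero_rpow hρ.1.ne']
  ring

/-- `Γ(-ρ)` changes sign with `ρ`, and so does the direction of monotonicity of `t ↦ t ^ ρ`; the two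
effects cancel. -/
lemma gtscSlope_strictMonoOn {q d c α ρ : ℝ} (hα : 0 < α) (hd : 0 ≤ d) (hc : 0 < c) :
    ρ ∈ Ico (-1 : ℝ) 1 → StrictMonoOn (gtscSlope q d c α ρ) (Iio α) := by
  intro hρ x hx y hy hxy
  simp only [mem_Iio] at hx hy
  have hdxy : d * x ≤ d * y := by gcongr
  unfold gtscSlope
  split_ifs with h0
  · have : Real.log (α / (α - x)) < Real.log (α / (α - y)) :=
      Real.log_lt_log (div_pos hα (by linarith)) (by gcongr)
    nlinarith
  · rcases lt_or_gt_of_ne h0 with h | h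
    · have hG : 0 < Real.Gamma (-ρ) := Real.Gamma_pos_of_pos (by linarith)
      have hp : (α - x) ^ ρ < (α - y) ^ ρ :=
        Real.rpow_lt_rpow_of_neg (by linarith) (by linarith) h
      nlinarith [mul_lt_mul_of_pos_left hp (mul_pos hc hG)]
    · have hG := Gamma_neg_lt_zero ⟨h, hρ.2⟩
      have hp : (α - y) ^ ρ < (α - x) ^ ρ :=
        Real.rpow_lt_rpow (by linarith) (by linarith) h
      nlinarith [mul_lt_mul_of_neg_left hp (mul_neg_of_pos_of_neg hc hG)]

lemma gtscSlope_continuousOn {q d c α ρ : ℝ} (hα : 0 < α) :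
    ContinuousOn (gtscSlope q d c α ρ) (Iio α) := by
  unfold gtscSlope
  intro x hx
  have hx' : α - x ≠ 0 := (sub_pos.mpr hx).ne'
  apply ContinuousAt.continuousWithinAt
  split_ifs
  · exact ((by fun_prop : ContinuousAt (fun θ => d * θ - q) x)).add (continuousAt_const.mul
      ((continuousAt_const.div (by fun_prop) hx').log (div_ne_zero hα.ne' hx')))
  · exact (by fun_prop : ContinuousAt (fun θ => d * θ - q) x).sub (continuousAt_const.mul
      (continuousAt_const.sub ((by fun_prop : ContinuousAt (fun θ => α - θ) x).rpow_const
        (Or.inl hx'))))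

lemma gtscSlope_continuous {q d c α ρ : ℝ} (hρ : ρ ∈ Ioo (0 : ℝ) 1) :
    Continuous (gtscSlope q d c α ρ) := by
  have h0 : gtscSlope q d c α ρ =
      fun θ => d * θ - q - c * Real.Gamma (-ρ) * (α ^ ρ - (α - θ) ^ ρ) :=
    funext fun θ => if_neg hρ.1.ne'
  rw [h0]
  have : Continuous fun θ : ℝ => (α - θ) ^ ρ :=
    (by fun_prop : Continuous fun θ : ℝ => α - θ).rpow_const fun _ => Or.inr hρ.1.le
  fun_prop

lemma tendsto_sub_nhdsLT (α : ℝ) : Tendsto (fun θ : ℝ => α - θ) (𝓝[<] α) (𝓝[>] 0) := by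
  refine tendsto_nhdsWithin_iff.mpr ⟨?_, ?_⟩
  · have : Tendsto (fun θ : ℝ => α - θ) (𝓝 α) (𝓝 (α - α)) :=
      (by fun_prop : Continuous fun θ : ℝ => α - θ).tendsto α
    rw [sub_self] at this
    exact this.mono_left nhdsWithin_le_nhds
  · filter_upwards [self_mem_nhdsWithin] with θ hθ using mem_Ioi.mpr (sub_pos.mpr (mem_Iio.mp hθ))

lemma gtscSlope_tendsto_atTop {q d c α ρ : ℝ} (hα : 0 < α) (hc : 0 < c) (hρ : ρ ≤ 0) :
    Tendsto (gtscSlope q d c α ρ) (𝓝[<] α) atTop := by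
  have hlin : Tendsto (fun θ : ℝ => d * θ - q) (𝓝[<] α) (𝓝 (d * α - q)) :=
    ((by fun_prop : Continuous fun θ : ℝ => d * θ - q).tendsto α).mono_left nhdsWithin_le_nhds
  have hs := tendsto_sub_nhdsLT α
  unfold gtscSlope
  split_ifs with h0
  · refine hlin.add_atTop (Tendsto.const_mul_atTop hc (Real.tendsto_log_atTop.comp ?_))
    exact (tendsto_inv_nhdsGT_zero.comp hs).const_mul_atTop hα
  · have hneg : ρ < 0 := lt_of_le_of_ne hρ h0
    have hG : 0 < Real.Gamma (-ρ) := Real.Gamma_pos_of_pos (by linarith)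
    have hp : Tendsto (fun θ : ℝ => (α - θ) ^ ρ) (𝓝[<] α) atTop :=
      (tendsto_rpow_neg_nhdsGT_zero hneg).comp hs
    have := hlin.add_atTop (Tendsto.const_mul_atTop (mul_pos hc hG)
      (tendsto_atTop_add_const_right _ (-α ^ ρ) hp))
    refine this.congr fun θ => ?_
    ring

/-- The slope changes sign on `(0, α)` as soon as it is eventually positive near `α`. -/
lemma exists_gtscSlope_eq_zero {q d c α ρ : ℝ} (hα : 0 < α) (hq : 0 < q)
    (hpos : ∀ᶠ θ in 𝓝[<] α, 0 < gtscSlope q d c α ρ θ) :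
    ∃ ν₀ ∈ Ioo 0 α, gtscSlope q d c α ρ ν₀ = 0 := by
  obtain ⟨θ, hθ, hθ0⟩ := (hpos.and (Ioo_mem_nhdsLT hα)).exists
  have hcont : ContinuousOn (gtscSlope q d c α ρ) (Icc 0 θ) :=
    (gtscSlope_continuousOn hα).mono fun x hx => lt_of_le_of_lt hx.2 hθ0.2
  obtain ⟨ν₀, hν, h⟩ := intermediate_value_Ioo hθ0.1.le hcont
    (show (0 : ℝ) ∈ Ioo _ _ from ⟨by rw [gtscSlope_zero hα]; linarith, hθ⟩)
  exact ⟨ν₀, ⟨hν.1, hν.2.trans hθ0.2⟩, h⟩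

lemma gtscSlope_eventually_pos {q d c α ρ : ℝ} (hα : 0 < α) (hc : 0 < c)
    (h : ρ ∈ Icc (-1 : ℝ) 0 ∨
      (ρ ∈ Ioo (0 : ℝ) 1 ∧ 0 < d * α - q - c * α ^ ρ * Real.Gamma (-ρ))) :
    ∀ᶠ θ in 𝓝[<] α, 0 < gtscSlope q d c α ρ θ := by
  rcases h with h | ⟨h, h1⟩
  · exact (gtscSlope_tendsto_atTop hα hc h.2).eventually_gt_atTop 0
  · rw [← gtscSlope_self h] at h1
    exact nhdsWithin_le_nhds ((gtscSlope_continuous h).continuousAt.eventually_const_lt h1)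

/-! ### Analytic continuation and the complex Gamma integral -/

/-- The measure on `(0, ∞)` with density `k`. -/
def densityOnIoi (k : ℝ → ℝ) : Measure ℝ :=
  (volume.restrict (Ioi 0)).withDensity fun x => ENNReal.ofReal (k x)

section densityOnIoi

variable {E : Type*} [NormedAddCommGroup E] [NormedSpace ℝ E] {k : ℝ → ℝ}

lemma integrable_densityOnIoi_iff (hk : Measurable k) (hk0 : ∀ x > 0, 0 ≤ k x) {g : ℝ → E} :
    Integrable g (densityOnIoi k) ↔ IntegrableOn (fun x => k x • g x) (Ioi 0) := by
  rw [densityOnIoi, integrable_withDensity_iff_integrable_smul' hk.ennreal_ofReal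
    (ae_of_all _ fun _ => ENNReal.ofReal_lt_top)]
  refine integrableOn_congr_fun (fun x hx => ?_) measurableSet_Ioi
  simp only [ENNReal.toReal_ofReal (hk0 x hx)]

lemma integral_densityOnIoi (hk : Measurable k) (hk0 : ∀ x > 0, 0 ≤ k x) (g : ℝ → E) :
    ∫ x, g x ∂(densityOnIoi k) = ∫ x in Ioi 0, k x • g x := by
  rw [densityOnIoi, integral_withDensity_eq_integral_toReal_smul hk.ennreal_ofReal
    (ae_of_all _ fun _ => ENNReal.ofReal_lt_top)]
  refine setIntegral_congr_fun measurableSet_Ioi (fun x hx => ?_)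
  simp only [ENNReal.toReal_ofReal (hk0 x hx)]

end densityOnIoi

/-- The identity theorem on a left half-plane, for functions that agree on the real axis. -/
lemma AnalyticOnNhd.eqOn_re_lt_of_eqOn_real {f g : ℂ → ℂ} {b : ℝ}
    (hf : AnalyticOnNhd ℂ f {z | z.re < b}) (hg : AnalyticOnNhd ℂ g {z | z.re < b})
    (h : ∀ x : ℝ, x < b → f x = g x) : EqOn f g {z | z.re < b} := by
  refine hf.eqOn_of_preconnected_of_frequently_eq hg (convex_halfSpace_re_lt b).isPreconnected
    (z₀ := ((b - 1 : ℝ) : ℂ)) (by simp) ?_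
  have h_real : ∃ᶠ x : ℝ in 𝓝[≠] (b - 1), f x = g x := by
    refine Eventually.frequently ?_
    filter_upwards [nhdsWithin_le_nhds (Iio_mem_nhds (show b - 1 < b by linarith))] with x hx
    exact h x hx
  rw [frequently_iff_seq_forall] at h_real ⊢
  obtain ⟨xs, hx_tendsto, hx_eq⟩ := h_real
  refine ⟨fun n => xs n, ?_, hx_eq⟩
  rw [tendsto_nhdsWithin_iff] at hx_tendsto ⊢
  refine ⟨Complex.continuous_ofReal.continuousAt.tendsto.comp hx_tendsto.1, ?_⟩
  simpa [← Complex.ofReal_one, ← Complex.ofReal_sub, -Complex.ofReal_one] using hx_tendsto.2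

lemma Iio_subset_interior_integrableExpSet {Ω : Type*} [MeasurableSpace Ω] {Y : Ω → ℝ}
    {P : Measure Ω} {b : ℝ} (h : ∀ θ < b, Integrable (fun ω => Real.exp (θ * Y ω)) P) :
    Iio b ⊆ interior (integrableExpSet Y P) :=
  interior_maximal (fun θ hθ => h θ hθ) isOpen_Iio

lemma analyticOnNhd_complexMGF_re_lt {Ω : Type*} [MeasurableSpace Ω] {Y : Ω → ℝ}
    {P : Measure Ω} {b : ℝ} (h : ∀ θ < b, Integrable (fun ω => Real.exp (θ * Y ω)) P) :
    AnalyticOnNhd ℂ (complexMGF Y P) {z | z.re < b} :=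
  analyticOnNhd_complexMGF.mono fun _ hz => Iio_subset_interior_integrableExpSet h hz

lemma integrableOn_rpow_mul_exp_neg_mul {s b : ℝ} (hs : -1 < s) (hb : 0 < b) :
    IntegrableOn (fun x : ℝ => x ^ s * Real.exp (-b * x)) (Ioi 0) := by
  simpa using integrableOn_rpow_mul_exp_neg_mul_rpow hs one_pos hb

/-- The Gamma integral with a complex rate. -/
lemma integral_rpow_mul_cexp_neg_mul_Ioi {a : ℝ} (ha : 0 < a) {r : ℂ} (hr : 0 < r.re) :
    ∫ x in Ioi (0 : ℝ), x ^ (a - 1) • Complex.exp (-r * x) = r ^ (-a : ℂ) * Real.Gamma a := by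
  have hk : Measurable fun x : ℝ => x ^ (a - 1) := by fun_prop
  have hk0 : ∀ x : ℝ, x > 0 → 0 ≤ x ^ (a - 1) := fun x hx => by positivity
  have hint : ∀ θ < (0 : ℝ), Integrable (fun x => Real.exp (θ * id x))
      (densityOnIoi fun x : ℝ => x ^ (a - 1)) := fun θ hθ => by
    rw [integrable_densityOnIoi_iff hk hk0]
    simpa using integrableOn_rpow_mul_exp_neg_mul (s := a - 1) (by linarith) (neg_pos.mpr hθ)
  have hg : AnalyticOnNhd ℂ (fun z : ℂ => (-z) ^ (-a : ℂ) * Real.Gamma a) {z | z.re < 0} := by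
    intro z hz
    exact (analyticAt_id.neg.cpow analyticAt_const (Or.inl (by simpa using hz))).mul
      analyticAt_const
  -- The integral is the complex moment generating function, at `-r`, of the measure with density `x
  -- ^ (a - 1)`, so the real Gamma integral determines it.
  have := (analyticOnNhd_complexMGF_re_lt hint).eqOn_re_lt_of_eqOn_real hg (fun x hx => ?_)
    (show (-r) ∈ {z : ℂ | z.re < 0} by simpa using hr)
  · simp only [complexMGF, integral_densityOnIoi hk hk0, neg_neg, id] at this
    exact this
  · have hx' : 0 < -x := neg_pos.mpr hx
    rw [complexMGF_ofReal, mgf, integral_densityOnIoi hk hk0, ← Complex.ofReal_neg,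
      ← Complex.ofReal_neg, ← Complex.ofReal_cpow hx'.le, ← Complex.ofReal_mul]
    have := Real.integral_rpow_mul_exp_neg_mul_Ioi ha hx'
    rw [one_div, Real.inv_rpow hx'.le, ← Real.rpow_neg hx'.le] at this
    rw [← this]
    simp

lemma norm_cexp_I_mul_sub_one_sub_le (y : ℝ) :
    ‖Complex.exp (Complex.I * y) - 1 - Complex.I * y‖ ≤ 3 * y ^ 2 := by
  have hn : ‖Complex.I * (y : ℂ)‖ = |y| := by simp
  rcases le_or_gt |y| 1 with h | h
  · have := Complex.norm_exp_sub_one_sub_id_le (x := Complex.I * y) (by rwa [hn])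
    rw [hn, sq_abs] at this
    nlinarith [sq_nonneg y]
  · calc _ ≤ ‖Complex.exp (Complex.I * y) - 1‖ + ‖Complex.I * (y : ℂ)‖ := norm_sub_le _ _
      _ ≤ |y| + |y| := add_le_add Real.norm_exp_I_mul_ofReal_sub_one_le hn.le
      _ ≤ 3 * y ^ 2 := by rw [← sq_abs]; nlinarith

/-! ### The tempered density and its exponent -/

/-- The tail `c e^{-αx} x^{-1-ρ}` of the Lévy measure of a GTSC process with `ρ ∈ (0, 1)`. -/
def temperedTail (c α ρ x : ℝ) : ℝ := c * (Real.exp (-α * x) * x ^ (-1 - ρ))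

/-- The density `-d/dx (c e^{-αx} x^{-1-ρ})` of the Lévy measure of a GTSC process with
`ρ ∈ (0, 1)`. -/
def temperedDensity (c α ρ x : ℝ) : ℝ :=
  c * (Real.exp (-α * x) * (α * x ^ (-1 - ρ) + (1 + ρ) * x ^ (-2 - ρ)))

lemma hasDerivAt_temperedTail (c α ρ : ℝ) {x : ℝ} (hx : 0 < x) :
    HasDerivAt (temperedTail c α ρ) (-temperedDensity c α ρ x) x := by
  have h1 : HasDerivAt (fun x : ℝ => Real.exp (-α * x)) (Real.exp (-α * x) * (-α * 1)) x :=
    ((hasDerivAt_id x).const_mul (-α)).exp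
  have h2 : HasDerivAt (fun x : ℝ => x ^ (-1 - ρ)) ((-1 - ρ) * x ^ (-1 - ρ - 1)) x :=
    Real.hasDerivAt_rpow_const (Or.inl hx.ne')
  refine ((h1.mul h2).const_mul c).congr_deriv ?_
  unfold temperedDensity
  rw [show -1 - ρ - 1 = -2 - ρ by ring]
  ring

lemma measurable_temperedDensity (c α ρ : ℝ) : Measurable (temperedDensity c α ρ) := by
  unfold temperedDensity
  fun_prop

section

variable {c α ρ : ℝ}

lemma temperedDensity_pos (hα : 0 < α) (hc : 0 < c) (hρ : ρ ∈ Ioo (0 : ℝ) 1) :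
    ∀ x > 0, 0 < temperedDensity c α ρ x := by
  intro x hx
  have := hρ.1
  unfold temperedDensity
  positivity

lemma temperedTail_pos (hc : 0 < c) {x : ℝ} (hx : 0 < x) : 0 < temperedTail c α ρ x := by
  unfold temperedTail
  positivity

lemma tendsto_temperedTail_atTop (hα : 0 < α) :
    Tendsto (temperedTail c α ρ) atTop (𝓝 0) := by
  have := (tendsto_rpow_mul_exp_neg_mul_atTop_nhds_zero (-1 - ρ) α hα).const_mul c
  rw [mul_zero] at this
  refine this.congr fun x => ?_
  rw [temperedTail]
  ring

lemma integrableOn_sq_mul_temperedDensity (hα : 0 < α) (hρ : ρ ∈ Ioo (0 : ℝ) 1) :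
    IntegrableOn (fun x => x ^ 2 * temperedDensity c α ρ x) (Ioi 0) := by
  have h1 := integrableOn_rpow_mul_exp_neg_mul (s := 1 - ρ) (by linarith [hρ.2]) hα
  have h2 := integrableOn_rpow_mul_exp_neg_mul (s := -ρ) (by linarith [hρ.2]) hα
  refine IntegrableOn.congr_fun ((h1.const_mul (c * α)).add (h2.const_mul (c * (1 + ρ))))
    (fun x hx => ?_) measurableSet_Ioi
  have hx : 0 < x := hx
  have e1 : x ^ (1 - ρ) = x ^ 2 * x ^ (-1 - ρ) := by
    rw [← Real.rpow_natCast, ← Real.rpow_add hx]; norm_num; ring_nf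
  have e2 : x ^ (-ρ) = x ^ 2 * x ^ (-2 - ρ) := by
    rw [← Real.rpow_natCast, ← Real.rpow_add hx]; norm_num; ring_nf
  simp only [Pi.add_apply, temperedDensity, e1, e2]
  ring

/-- A primitive that evaluates the exponent of the Lévy measure with density
`temperedDensity c α ρ`. -/
def temperedPrimitive (c α ρ θ x : ℝ) : ℂ :=
  -(temperedTail c α ρ x * (Complex.exp (Complex.I * (θ * x : ℝ)) - 1 - Complex.I * (θ * x : ℝ))) -
    c * (Complex.I * θ / ρ) *
      ((x ^ (-ρ) : ℝ) * (Real.exp (-α * x) * (Complex.exp (Complex.I * (θ * x : ℝ)) - 1)))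

/-- Two integrations by parts in one: the first replaces the density by its tail, the second trades
`x ^ (-1 - ρ)` for `x ^ (-ρ)`, which is integrable at `0` when `ρ < 1`. The terms with `x ^ (-1 -
ρ)` cancel, and what remains besides the wanted integrand is a pair of Gamma integrands. -/
lemma hasDerivAt_temperedPrimitive (hρ : ρ ≠ 0) (θ : ℝ) {x : ℝ} (hx : 0 < x) :
    HasDerivAt (temperedPrimitive c α ρ θ)
      (temperedDensity c α ρ x *
          (Complex.exp (Complex.I * (θ * x : ℝ)) - 1 - Complex.I * (θ * x : ℝ)) -
        c * (Complex.I * θ / ρ) *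
          ((x ^ (-ρ) : ℝ) * ((Complex.I * θ - α) * (Real.exp (-α * x) *
            Complex.exp (Complex.I * (θ * x : ℝ))) + α * Real.exp (-α * x)))) x := by
  have hρ' : (ρ : ℂ) ≠ 0 := by exact_mod_cast hρ
  have h1 := (hasDerivAt_temperedTail c α ρ hx).ofReal_comp
  have h2 : HasDerivAt (fun x : ℝ => Complex.I * (θ * x : ℝ)) (Complex.I * (θ * 1 : ℝ)) x :=
    ((hasDerivAt_id x).const_mul θ).ofReal_comp.const_mul _
  have h3 := h2.cexp.sub_const 1
  have h4 : HasDerivAt (fun x : ℝ => ((x ^ (-ρ) : ℝ) : ℂ)) ((-ρ * x ^ (-ρ - 1) : ℝ) : ℂ) x :=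
    (Real.hasDerivAt_rpow_const (Or.inl hx.ne')).ofReal_comp
  have h5 : HasDerivAt (fun x : ℝ => ((Real.exp (-α * x) : ℝ) : ℂ))
      ((Real.exp (-α * x) * (-α * 1) : ℝ) : ℂ) x :=
    ((hasDerivAt_id x).const_mul (-α)).exp.ofReal_comp
  refine ((h1.mul (h3.sub h2)).neg.sub
    ((h4.mul (h5.mul h3)).const_mul (c * (Complex.I * θ / ρ)))).congr_deriv ?_
  simp only [Pi.sub_apply, Pi.mul_apply]
  rw [show -ρ - 1 = -1 - ρ by ring, temperedTail]
  push_cast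
  field_simp
  ring

/-- For `ρ < 1` and `α > 0` the bound vanishes at `0` and at infinity, so the integrations by parts
leave no boundary terms. -/
lemma norm_temperedPrimitive_le (hc : 0 < c) (hρ : 0 < ρ) (θ : ℝ) {x : ℝ} (hx : 0 < x) :
    ‖temperedPrimitive c α ρ θ x‖ ≤
      c * (3 * θ ^ 2 + θ ^ 2 / ρ) * (x ^ (1 - ρ) * Real.exp (-α * x)) := by
  have e1 : x ^ (1 - ρ) = x ^ 2 * x ^ (-1 - ρ) := by
    rw [← Real.rpow_natCast, ← Real.rpow_add hx]; norm_num; ring_nf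
  have e2 : x ^ (1 - ρ) = x * x ^ (-ρ) := by
    rw [sub_eq_add_neg, Real.rpow_add hx, Real.rpow_one]
  calc ‖temperedPrimitive c α ρ θ x‖
      ≤ ‖(temperedTail c α ρ x : ℂ)‖ *
          ‖Complex.exp (Complex.I * (θ * x : ℝ)) - 1 - Complex.I * (θ * x : ℝ)‖ +
        c * (|θ| / ρ) * (x ^ (-ρ) * (Real.exp (-α * x) *
          ‖Complex.exp (Complex.I * (θ * x : ℝ)) - 1‖)) := by
        refine (norm_sub_le _ _).trans (add_le_add (by rw [norm_neg, norm_mul]) (le_of_eq ?_))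
        simp only [norm_mul, norm_div, Complex.norm_I, Complex.norm_real, Real.norm_eq_abs,
          abs_of_pos hc, abs_of_pos hρ, Real.abs_exp, one_mul,
          abs_of_pos (Real.rpow_pos_of_pos hx _)]
    _ ≤ temperedTail c α ρ x * (3 * (θ * x) ^ 2) +
        c * (|θ| / ρ) * (x ^ (-ρ) * (Real.exp (-α * x) * |θ * x|)) := by
        rw [Complex.norm_real, Real.norm_of_nonneg (temperedTail_pos hc hx).le]
        have := temperedTail_pos (α := α) (ρ := ρ) hc hx
        gcongr
        · exact norm_cexp_I_mul_sub_one_sub_le _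
        · exact Real.norm_exp_I_mul_ofReal_sub_one_le
    _ = _ := by
        rw [mul_add, add_mul]
        congr 1
        · rw [e1, temperedTail]; ring
        · rw [e2, abs_mul, abs_of_pos hx, ← sq_abs θ]; ring

lemma tendsto_temperedPrimitive_atTop (hα : 0 < α) (hc : 0 < c) (hρ : ρ ∈ Ioo (0 : ℝ) 1) (θ : ℝ) :
    Tendsto (temperedPrimitive c α ρ θ) atTop (𝓝 0) := by
  have := (tendsto_rpow_mul_exp_neg_mul_atTop_nhds_zero (1 - ρ) α hα).const_mul
    (c * (3 * θ ^ 2 + θ ^ 2 / ρ))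
  rw [mul_zero] at this
  refine squeeze_zero_norm' ?_ this
  filter_upwards [eventually_gt_atTop 0] with x hx using norm_temperedPrimitive_le hc hρ.1 θ hx

lemma continuousWithinAt_temperedPrimitive_zero (hc : 0 < c) (hρ : ρ ∈ Ioo (0 : ℝ) 1) (θ : ℝ) :
    ContinuousWithinAt (temperedPrimitive c α ρ θ) (Ici 0) 0 := by
  have h0 : temperedPrimitive c α ρ θ 0 = 0 := by simp [temperedPrimitive]
  rw [← continuousWithinAt_Ioi_iff_Ici, ContinuousWithinAt, h0]
  have hcont : ContinuousAt
      (fun x : ℝ => c * (3 * θ ^ 2 + θ ^ 2 / ρ) * (x ^ (1 - ρ) * Real.exp (-α * x))) 0 :=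
    continuousAt_const.mul ((Real.continuousAt_rpow_const _ _
      (Or.inr (by linarith [hρ.2]))).mul (by fun_prop))
  have := hcont.tendsto
  rw [Real.zero_rpow (by linarith [hρ.2]), zero_mul, mul_zero] at this
  refine squeeze_zero_norm' ?_ (this.mono_left nhdsWithin_le_nhds)
  filter_upwards [self_mem_nhdsWithin] with x hx using norm_temperedPrimitive_le hc hρ.1 θ hx

lemma integrableOn_temperedDensity_mul (hα : 0 < α) (hc : 0 < c) (hρ : ρ ∈ Ioo (0 : ℝ) 1)
    (θ : ℝ) :
    IntegrableOn (fun x : ℝ => (temperedDensity c α ρ x : ℂ) *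
      (Complex.exp (Complex.I * (θ * x : ℝ)) - 1 - Complex.I * (θ * x : ℝ))) (Ioi 0) := by
  refine Integrable.mono' ((integrableOn_sq_mul_temperedDensity (c := c) hα hρ).const_mul
    (3 * θ ^ 2)) ?_ ?_
  · exact (Complex.measurable_ofReal.comp (measurable_temperedDensity c α ρ)).mul
      (by fun_prop) |>.aestronglyMeasurable
  · filter_upwards [ae_restrict_mem measurableSet_Ioi] with x hx
    have hk := (temperedDensity_pos hα hc hρ x hx).le
    rw [norm_mul, Complex.norm_real, Real.norm_of_nonneg hk]
    calc _ ≤ temperedDensity c α ρ x * (3 * (θ * x) ^ 2) := by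
          gcongr
          exact norm_cexp_I_mul_sub_one_sub_le _
      _ = _ := by ring

lemma integrableOn_rpow_mul_cexp_neg_mul {s : ℝ} (hs : -1 < s) {r : ℂ} (hr : 0 < r.re) :
    IntegrableOn (fun x : ℝ => x ^ s • Complex.exp (-r * x)) (Ioi 0) := by
  refine Integrable.mono' (integrableOn_rpow_mul_exp_neg_mul hs hr) ?_ ?_
  · have : Measurable fun x : ℝ => x ^ s • Complex.exp (-r * x) := by fun_prop
    exact this.aestronglyMeasurable
  · filter_upwards [ae_restrict_mem measurableSet_Ioi] with x hx
    have hx : 0 < x := hx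
    rw [norm_smul, Complex.norm_exp, Real.norm_of_nonneg (by positivity)]
    simp

/-- The compensated exponent of the Lévy measure with density `temperedDensity c α ρ`. -/
lemma integral_temperedDensity_mul (hα : 0 < α) (hc : 0 < c) (hρ : ρ ∈ Ioo (0 : ℝ) 1) (θ : ℝ) :
    ∫ x in Ioi (0 : ℝ), (temperedDensity c α ρ x : ℂ) *
        (Complex.exp (Complex.I * (θ * x : ℝ)) - 1 - Complex.I * (θ * x : ℝ)) =
      -c * (Complex.I * θ) * Real.Gamma (-ρ) *
        ((α : ℂ) ^ (ρ : ℂ) - (α - Complex.I * θ) ^ (ρ : ℂ)) := by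
  have hρ0 : (ρ : ℂ) ≠ 0 := by exact_mod_cast hρ.1.ne'
  set w : ℂ := Complex.I * θ with hw
  have hwre : w.re = 0 := by simp [hw]
  have hr1 : 0 < ((α : ℂ) - w).re := by simp [hwre, hα]
  have hr2 : 0 < (α : ℂ).re := by simpa using hα
  have hs : -1 < -ρ := by linarith [hρ.2]
  have i1 := integrableOn_temperedDensity_mul hα hc hρ θ
  have i2 := integrableOn_rpow_mul_cexp_neg_mul hs hr1
  have i3 := integrableOn_rpow_mul_cexp_neg_mul hs hr2
  have i4 : IntegrableOn (fun x : ℝ => c * (w / ρ) *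
      ((w - α) * (x ^ (-ρ) • Complex.exp (-(α - w) * x)) +
        α * (x ^ (-ρ) • Complex.exp (-α * x)))) (Ioi 0) := ((i2.const_mul (w - α)).add (i3.const_mul (α : ℂ))).const_mul (c * (w / ρ))
  have heq : ∀ x : ℝ, c * (w / ρ) *
      ((x ^ (-ρ) : ℝ) * ((w - α) * (Real.exp (-α * x) * Complex.exp (Complex.I * (θ * x : ℝ))) +
        α * Real.exp (-α * x))) =
      c * (w / ρ) * ((w - α) * (x ^ (-ρ) • Complex.exp (-(α - w) * x)) +
        α * (x ^ (-ρ) • Complex.exp (-α * x))) := fun x => by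
    have e1 : Complex.exp (-(α - w) * x) =
        Real.exp (-α * x) * Complex.exp (Complex.I * (θ * x : ℝ)) := by
      rw [Complex.ofReal_exp, ← Complex.exp_add, hw]
      push_cast
      ring_nf
    have e2 : Complex.exp (-α * x) = Real.exp (-α * x) := by simp
    rw [e1, e2, Complex.real_smul, Complex.real_smul]
    ring
  -- The primitive vanishes at both ends, so its derivative integrates to zero and the compensated
  -- integral equals the Gamma integrals.
  have key := integral_Ioi_of_hasDerivAt_of_tendsto
    (continuousWithinAt_temperedPrimitive_zero (α := α) hc hρ θ)
    (fun x hx => hasDerivAt_temperedPrimitive hρ.1.ne' θ hx)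
    (by simp only [← hw, heq]; exact i1.sub i4)
    (tendsto_temperedPrimitive_atTop hα hc hρ θ)
  simp only [← hw, heq] at key
  rw [integral_sub i1 i4, show temperedPrimitive c α ρ θ 0 = 0 by simp [temperedPrimitive],
    sub_zero, sub_eq_zero] at key
  rw [key, integral_const_mul, integral_add (i2.const_mul _) (i3.const_mul _),
    integral_const_mul, integral_const_mul]
  have ha : 0 < 1 - ρ := by linarith [hρ.2]
  have g1 := integral_rpow_mul_cexp_neg_mul_Ioi ha hr1
  have g2 := integral_rpow_mul_cexp_neg_mul_Ioi ha hr2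
  rw [show 1 - ρ - 1 = -ρ by ring] at g1 g2
  rw [g1, g2, Gamma_one_sub_eq hρ.1.ne']
  -- The Gamma integrals come with the exponent `ρ - 1`; this brings the target to the same powers.
  have hz : ∀ z : ℂ, 0 < z.re → z ^ (ρ : ℂ) = z * z ^ (-((1 - ρ : ℝ) : ℂ)) := fun z hz => by
    have hz0 : z ≠ 0 := fun h => by simp [h] at hz
    rw [show (ρ : ℂ) = 1 + -((1 - ρ : ℝ) : ℂ) by push_cast; ring, Complex.cpow_add _ _ hz0,
      Complex.cpow_one]
  rw [hz _ hr1, hz _ hr2]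
  push_cast
  field_simp
  ring

end

/-! ### The tempered Lévy measure and its tail -/

/-- The Lévy measure of a GTSC process with `ρ ∈ (0, 1)`. -/
def temperedMeasure (c α ρ : ℝ) : Measure ℝ := densityOnIoi (temperedDensity c α ρ)

section

variable {c α ρ : ℝ}

lemma temperedMeasure_apply {s : Set ℝ} (hs : MeasurableSet s) :
    temperedMeasure c α ρ s =
      ∫⁻ x in s ∩ Ioi 0, ENNReal.ofReal (temperedDensity c α ρ x) := by
  rw [temperedMeasure, densityOnIoi, withDensity_apply _ hs, Measure.restrict_restrict hs]

lemma integrableOn_temperedDensity_Ioi (hα : 0 < α) (hc : 0 < c) (hρ : ρ ∈ Ioo (0 : ℝ) 1) {u : ℝ}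
    (hu : 0 < u) : IntegrableOn (temperedDensity c α ρ) (Ioi u) := by
  have := integrableOn_Ioi_deriv_of_nonpos'
    (fun x hx => hasDerivAt_temperedTail c α ρ (hu.trans_le hx))
    (fun x hx => neg_nonpos.mpr (temperedDensity_pos hα hc hρ x (hu.trans hx)).le)
    (tendsto_temperedTail_atTop hα)
  simpa using this.neg

lemma temperedMeasure_Ioi (hα : 0 < α) (hc : 0 < c) (hρ : ρ ∈ Ioo (0 : ℝ) 1) {u : ℝ}
    (hu : 0 < u) : temperedMeasure c α ρ (Ioi u) = ENNReal.ofReal (temperedTail c α ρ u) := by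
  have := integral_Ioi_of_hasDerivAt_of_nonpos'
    (fun x hx => hasDerivAt_temperedTail c α ρ (hu.trans_le hx))
    (fun x hx => neg_nonpos.mpr (temperedDensity_pos hα hc hρ x (hu.trans hx)).le)
    (tendsto_temperedTail_atTop hα)
  rw [integral_neg, zero_sub, neg_inj] at this
  rw [temperedMeasure_apply measurableSet_Ioi, Ioi_inter_Ioi, sup_of_le_left hu.le, ← this,
    ofReal_integral_eq_lintegral_ofReal (integrableOn_temperedDensity_Ioi hα hc hρ hu)]
  filter_upwards [ae_restrict_mem measurableSet_Ioi] with x hx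
    using (temperedDensity_pos hα hc hρ x (hu.trans hx)).le

lemma integrable_sq_temperedMeasure (hα : 0 < α) (hc : 0 < c) (hρ : ρ ∈ Ioo (0 : ℝ) 1) :
    Integrable (fun x => x ^ 2) (temperedMeasure c α ρ) := by
  rw [temperedMeasure, integrable_densityOnIoi_iff (measurable_temperedDensity c α ρ)
    fun x hx => (temperedDensity_pos hα hc hρ x hx).le]
  simpa [mul_comm] using integrableOn_sq_mul_temperedDensity (c := c) hα hρ

lemma isLevyMeasure_temperedMeasure (hα : 0 < α) (hc : 0 < c) (hρ : ρ ∈ Ioo (0 : ℝ) 1) :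
    IsLevyMeasure (temperedMeasure c α ρ) where
  zero := by simp [temperedMeasure_apply (measurableSet_singleton (0 : ℝ))]
  integrable := by
    refine lt_of_le_of_lt (lintegral_mono fun x => ?_)
      (integrable_sq_temperedMeasure hα hc hρ).lintegral_lt_top
    exact ENNReal.ofReal_le_ofReal (min_le_right _ _)

/-- The mean of the jumps of size at least `1`. -/
def temperedBigJumpMean (c α ρ : ℝ) : ℝ :=
  ∫ x, (if |x| < 1 then 0 else x) ∂(temperedMeasure c α ρ)

/-- Large jumps have a finite mean, so the truncated compensator can be replaced by the full one
`iθx` at the price of a drift; the correction in `γ` absorbs it. The Gaussian coefficient is `2 * d`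
because the exponent contains `s θ² / 2`. -/
lemma levyKhintchineExponent_temperedMeasure (hα : 0 < α) (hc : 0 < c)
    (hρ : ρ ∈ Ioo (0 : ℝ) 1) (q d θ : ℝ) :
    levyKhintchineExponent (-q - temperedBigJumpMean c α ρ) (2 * d) (temperedMeasure c α ρ) θ =
      -q * (θ * Complex.I) + d * (θ * Complex.I) ^ 2 - c * (θ * Complex.I) * Real.Gamma (-ρ) *
        ((α : ℂ) ^ (ρ : ℂ) - (α - θ * Complex.I) ^ (ρ : ℂ)) := by
  have hm := measurable_temperedDensity c α ρ
  have h0 : ∀ x > 0, 0 ≤ temperedDensity c α ρ x :=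
    fun x hx => (temperedDensity_pos hα hc hρ x hx).le
  have i1 : Integrable (fun x : ℝ => Complex.exp (Complex.I * (θ * x : ℝ)) - 1 -
      Complex.I * (θ * x : ℝ)) (temperedMeasure c α ρ) := by
    rw [temperedMeasure, integrable_densityOnIoi_iff hm h0]
    simpa using integrableOn_temperedDensity_mul hα hc hρ θ
  have hmeas : Measurable fun x : ℝ => if |x| < 1 then (0 : ℝ) else x :=
    Measurable.ite (measurableSet_lt (by fun_prop) measurable_const) measurable_const
      measurable_id
  have i2 : Integrable (fun x : ℝ => if |x| < 1 then (0 : ℝ) else x) (temperedMeasure c α ρ) := by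
    refine (integrable_sq_temperedMeasure hα hc hρ).mono' hmeas.aestronglyMeasurable
      (ae_of_all _ fun x => ?_)
    split_ifs with h
    · simpa using sq_nonneg x
    · rw [Real.norm_eq_abs, ← sq_abs]
      nlinarith [not_lt.mp h]
  have hsplit : ∀ x : ℝ, Complex.exp (Complex.I * θ * x) - 1 -
      Complex.I * θ * (if |x| < 1 then (x : ℂ) else 0) =
      (Complex.exp (Complex.I * (θ * x : ℝ)) - 1 - Complex.I * (θ * x : ℝ)) +
        Complex.I * θ * ((if |x| < 1 then (0 : ℝ) else x : ℝ) : ℂ) := fun x => by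
    split_ifs <;> push_cast <;> ring_nf
  have i3 : Integrable (fun x : ℝ => Complex.I * θ * ((if |x| < 1 then (0 : ℝ) else x : ℝ) : ℂ))
      (temperedMeasure c α ρ) := i2.ofReal.const_mul _
  rw [levyKhintchineExponent]
  simp_rw [hsplit]
  rw [integral_add i1 i3, integral_const_mul, integral_complex_ofReal,
    ← temperedBigJumpMean, temperedMeasure, integral_densityOnIoi hm h0]
  simp only [Complex.real_smul]
  rw [integral_temperedDensity_mul hα hc hρ θ]
  push_cast
  rw [mul_pow, Complex.I_sq, mul_comm Complex.I (θ : ℂ)]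
  ring

lemma tail_ratio_temperedTail (hc : c ≠ 0) {u v : ℝ} (hu : 0 < u) (hv : 0 < v) :
    temperedTail c α ρ v / temperedTail c α ρ u =
      Real.exp (α * (u - v)) * (v / u) ^ (-1 - ρ) := by
  have := (Real.rpow_pos_of_pos hu (-1 - ρ)).ne'
  rw [temperedTail, temperedTail, mul_div_mul_left _ _ hc, mul_div_mul_comm, ← Real.exp_sub,
    ← Real.div_rpow hv.le hu.le]
  ring_nf

lemma cond_temperedMeasure_real_Ioi (hα : 0 < α) (hc : 0 < c) (hρ : ρ ∈ Ioo (0 : ℝ) 1) {x₀ u : ℝ}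
    (hx₀ : 0 < x₀) (hu : x₀ ≤ u) :
    (cond (temperedMeasure c α ρ) (Ioi x₀)).real (Ioi u) =
      temperedTail c α ρ u / temperedTail c α ρ x₀ := by
  rw [measureReal_def, cond_apply measurableSet_Ioi, Ioi_inter_Ioi, sup_of_le_right hu,
    temperedMeasure_Ioi hα hc hρ hx₀, temperedMeasure_Ioi hα hc hρ (hx₀.trans_le hu),
    ENNReal.toReal_mul, ENNReal.toReal_inv, ENNReal.toReal_ofReal (temperedTail_pos hc hx₀).le,
    ENNReal.toReal_ofReal (temperedTail_pos hc (hx₀.trans_le hu)).le]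
  ring

/-- The normalisation cancels. Both the limit defining `L^(α)` and the domination needed for the
convolution are read off this formula. -/
lemma cond_temperedMeasure_tail_ratio (hα : 0 < α) (hc : 0 < c) (hρ : ρ ∈ Ioo (0 : ℝ) 1)
    {x₀ u v : ℝ} (hx₀ : 0 < x₀) (hu : x₀ ≤ u) (hv : x₀ ≤ v) :
    (cond (temperedMeasure c α ρ) (Ioi x₀)).real (Ioi v) /
      (cond (temperedMeasure c α ρ) (Ioi x₀)).real (Ioi u) =
      Real.exp (α * (u - v)) * (v / u) ^ (-1 - ρ) := by
  rw [cond_temperedMeasure_real_Ioi hα hc hρ hx₀ hu, cond_temperedMeasure_real_Ioi hα hc hρ hx₀ hv,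
    div_div_div_cancel_right₀ (temperedTail_pos hc hx₀).ne',
    tail_ratio_temperedTail hc.ne' (hx₀.trans_le hu) (hx₀.trans_le hv)]

lemma tendsto_cond_temperedMeasure_tail_ratio (hα : 0 < α) (hc : 0 < c)
    (hρ : ρ ∈ Ioo (0 : ℝ) 1) {x₀ : ℝ} (hx₀ : 0 < x₀) (x : ℝ) :
    Tendsto (fun u => (cond (temperedMeasure c α ρ) (Ioi x₀)).real (Ioi (u - x)) /
      (cond (temperedMeasure c α ρ) (Ioi x₀)).real (Ioi u)) atTop (𝓝 (Real.exp (α * x))) := by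
  have h1 : Tendsto (fun u : ℝ => (u - x) / u) atTop (𝓝 1) := by
    have : Tendsto (fun u : ℝ => 1 - x / u) atTop (𝓝 (1 - 0)) :=
      tendsto_const_nhds.sub (tendsto_const_nhds.div_atTop tendsto_id)
    rw [sub_zero] at this
    refine this.congr' ?_
    filter_upwards [eventually_gt_atTop 0] with u hu
    field_simp
  have h2 := (h1.rpow_const (p := -1 - ρ) (Or.inl one_ne_zero)).const_mul (Real.exp (α * x))
  rw [Real.one_rpow, mul_one] at h2
  refine h2.congr' ?_
  filter_upwards [eventually_ge_atTop x₀, eventually_ge_atTop (x₀ + x)] with u hu hv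
  rw [cond_temperedMeasure_tail_ratio hα hc hρ hx₀ hu (by linarith)]
  ring_nf

lemma isProbabilityMeasure_cond_temperedMeasure (hα : 0 < α) (hc : 0 < c)
    (hρ : ρ ∈ Ioo (0 : ℝ) 1) {x₀ : ℝ} (hx₀ : 0 < x₀) :
    IsProbabilityMeasure (cond (temperedMeasure c α ρ) (Ioi x₀)) := by
  refine cond_isProbabilityMeasure_of_finite ?_ ?_ <;>
    rw [temperedMeasure_Ioi hα hc hρ hx₀]
  · simpa using temperedTail_pos hc hx₀
  · exact ENNReal.ofReal_ne_top

/-- The weight `e^{αx}` cancels the tempering exactly and leaves powers that are integrable at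
infinity because `ρ > 0`. -/
lemma integrable_exp_cond_temperedMeasure (hα : 0 < α) (hc : 0 < c)
    (hρ : ρ ∈ Ioo (0 : ℝ) 1) {x₀ : ℝ} (hx₀ : 0 < x₀) :
    Integrable (fun x => Real.exp (α * x)) (cond (temperedMeasure c α ρ) (Ioi x₀)) := by
  rw [ProbabilityTheory.cond]
  refine Integrable.smul_measure ?_ ?_
  · rw [← IntegrableOn, ← integrable_indicator_iff measurableSet_Ioi, temperedMeasure,
      integrable_densityOnIoi_iff (measurable_temperedDensity c α ρ)
      fun x hx => (temperedDensity_pos hα hc hρ x hx).le]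
    have i1 := (integrableOn_Ioi_rpow_of_lt (a := -1 - ρ) (by linarith [hρ.1]) hx₀).const_mul
      (c * α)
    have i2 := (integrableOn_Ioi_rpow_of_lt (a := -2 - ρ) (by linarith [hρ.1]) hx₀).const_mul
      (c * (1 + ρ))
    have i3 : IntegrableOn (fun x => temperedDensity c α ρ x • Real.exp (α * x)) (Ioi x₀) := by
      refine IntegrableOn.congr_fun (i1.add i2) (fun x hx => ?_) measurableSet_Ioi
      have : Real.exp (-α * x) * Real.exp (α * x) = 1 := by
        rw [← Real.exp_add]; simp
      simp only [Pi.add_apply, temperedDensity, smul_eq_mul]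
      linear_combination (-c * (α * x ^ (-1 - ρ) + (1 + ρ) * x ^ (-2 - ρ))) * this
    refine Integrable.integrableOn (((integrable_indicator_iff measurableSet_Ioi).mpr i3).congr
      (ae_of_all _ fun x => ?_))
    by_cases h : x ∈ Ioi x₀ <;> simp [indicator, h]
  · rw [temperedMeasure_Ioi hα hc hρ hx₀]
    simpa using temperedTail_pos hc hx₀

end

/-! ### Convolution equivalence of the tempered tail -/

/-- The tail of `F * F` splits according to which summand exceeds `x / 2`. -/
lemma conv_self_real_Ioi (F : Measure ℝ) [IsProbabilityMeasure F] (x : ℝ) :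
    (Measure.conv F F).real (Ioi x) =
      2 * ∫ y, (Iic (x / 2)).indicator (fun y => F.real (Ioi (x - y))) y ∂F +
        F.real (Ioi (x / 2)) ^ 2 := by
  set A : Set (ℝ × ℝ) := {p | p.1 ≤ x / 2 ∧ x < p.1 + p.2} with hA
  have hAm : MeasurableSet A :=
    (measurableSet_le measurable_fst measurable_const).inter
      (measurableSet_lt measurable_const (measurable_fst.add measurable_snd))
  have hBm : MeasurableSet (Prod.swap ⁻¹' A) := measurable_swap hAm
  have hpre : (fun p : ℝ × ℝ => p.1 + p.2) ⁻¹' Ioi x =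
      (A ∪ Prod.swap ⁻¹' A) ∪ Ioi (x / 2) ×ˢ Ioi (x / 2) := by
    ext ⟨y, z⟩
    simp only [hA, mem_preimage, mem_Ioi, mem_union, mem_ofPred_eq, Prod.swap_prod_mk, mem_prod]
    constructor
    · intro h
      by_cases h1 : y ≤ x / 2
      · exact Or.inl (Or.inl ⟨h1, h⟩)
      · by_cases h2 : z ≤ x / 2
        · exact Or.inl (Or.inr ⟨h2, by linarith⟩)
        · exact Or.inr ⟨not_le.mp h1, not_le.mp h2⟩
    · rintro ((h | h) | h) <;> linarith [h.1, h.2]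
  have hd1 : Disjoint A (Prod.swap ⁻¹' A) := by
    rw [Set.disjoint_left]
    rintro ⟨y, z⟩ h1 h2
    simp only [hA, mem_preimage, mem_ofPred_eq, Prod.swap_prod_mk] at h1 h2
    linarith [h1.1, h1.2, h2.1, h2.2]
  have hd2 : Disjoint (A ∪ Prod.swap ⁻¹' A) (Ioi (x / 2) ×ˢ Ioi (x / 2)) := by
    rw [Set.disjoint_left]
    rintro ⟨y, z⟩ h1 h2
    simp only [hA, mem_preimage, mem_ofPred_eq, Prod.swap_prod_mk, mem_union, mem_prod,
      mem_Ioi] at h1 h2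
    rcases h1 with h1 | h1 <;> linarith [h1.1, h1.2, h2.1, h2.2]
  have hswap : (F.prod F).real (Prod.swap ⁻¹' A) = (F.prod F).real A := by
    rw [measureReal_def, measureReal_def, ← Measure.map_apply measurable_swap hAm,
      Measure.prod_swap]
  have hAF : (F.prod F).real A =
      ∫ y, (Iic (x / 2)).indicator (fun y => F.real (Ioi (x - y))) y ∂F := by
    rw [measureReal_def, Measure.prod_apply hAm, ← integral_toReal
      (measurable_measure_prodMk_left hAm).aemeasurable (ae_of_all _ fun _ => measure_lt_top _ _)]
    refine integral_congr_ae (ae_of_all _ fun y => ?_)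
    simp only [hA]
    by_cases h : y ≤ x / 2
    · rw [indicator_of_mem (show y ∈ Iic (x / 2) from h), measureReal_def]
      congr 2
      ext z
      simp [h, sub_lt_iff_lt_add']
    · rw [indicator_of_notMem (show y ∉ Iic (x / 2) from h)]
      simp [h]
  rw [measureReal_def, Measure.conv, Measure.map_apply measurable_add measurableSet_Ioi, hpre,
    ← measureReal_def, measureReal_union hd2 (measurableSet_Ioi.prod measurableSet_Ioi),
    measureReal_union hd1 hBm, hswap, hAF, measureReal_prod_prod]
  ring

/-- A tempered power tail is convolution equivalent. -/
lemma isConvolutionEquivalent_cond_temperedMeasure {c α ρ : ℝ} (hα : 0 < α) (hc : 0 < c)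
    (hρ : ρ ∈ Ioo (0 : ℝ) 1) {x₀ : ℝ} (hx₀ : 0 < x₀) :
    IsConvolutionEquivalent α (cond (temperedMeasure c α ρ) (Ioi x₀)) := by
  have hprob := isProbabilityMeasure_cond_temperedMeasure hα hc hρ hx₀
  have hint := integrable_exp_cond_temperedMeasure hα hc hρ hx₀
  have hlong := tendsto_cond_temperedMeasure_tail_ratio hα hc hρ hx₀
  have hratio : ∀ {u v : ℝ}, _ → _ → _ :=
    fun {u v} => cond_temperedMeasure_tail_ratio (u := u) (v := v) hα hc hρ hx₀
  have htail : ∀ {u : ℝ}, _ → _ :=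
    fun {u} => cond_temperedMeasure_real_Ioi (u := u) hα hc hρ hx₀
  set F := cond (temperedMeasure c α ρ) (Ioi x₀) with hF
  refine ⟨⟨hprob, ?_, hlong⟩, hint, ?_⟩
  · rw [hF, cond_apply measurableSet_Ioi]
    have : Ioi x₀ ∩ Iio 0 = ∅ := by
      ext y
      simp only [mem_inter_iff, mem_Ioi, mem_Iio, mem_empty_iff_false, iff_false, not_and]
      intro h
      linarith
    rw [this, measure_empty, mul_zero]
  have hmeas : ∀ x, Measurable fun y => F.real (Ioi (x - y)) := fun x =>
    (show Monotone fun y => F.real (Ioi (x - y)) from fun y z hyz =>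
      measureReal_mono (Ioi_subset_Ioi (by linarith))).measurable
  have hdom : Tendsto (fun x => ∫ y, (Iic (x / 2)).indicator
      (fun y => F.real (Ioi (x - y)) / F.real (Ioi x)) y ∂F) atTop
      (𝓝 (∫ y, Real.exp (α * y) ∂F)) := by
    -- For `y ≤ x / 2` one has `(x - y) / x ≥ 1 / 2`, and the exponent `-1 - ρ` is negative: this
    -- gives the constant in the dominating function.
    refine tendsto_integral_filter_of_dominated_convergence
      (fun y => Real.exp (α * y) * (1 / 2 : ℝ) ^ (-1 - ρ)) ?_ ?_ (hint.mul_const _) ?_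
    · exact Eventually.of_forall fun x =>
        (((hmeas x).div_const _).indicator measurableSet_Iic).aestronglyMeasurable
    · filter_upwards [eventually_ge_atTop (2 * x₀)] with x hx
      refine ae_of_all _ fun y => ?_
      by_cases h : y ∈ Iic (x / 2)
      · have h' : y ≤ x / 2 := h
        rw [indicator_of_mem h, Real.norm_of_nonneg (by positivity),
          hratio (by linarith) (by linarith)]
        rw [show x - (x - y) = y by ring]
        refine mul_le_mul_of_nonneg_left ?_ (Real.exp_pos _).le
        refine Real.rpow_le_rpow_of_nonpos (by norm_num) ?_ (by linarith [hρ.1])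
        rw [le_div_iff₀ (by linarith)]
        linarith
      · rw [indicator_of_notMem h, norm_zero]
        positivity
    · refine ae_of_all _ fun y => (hlong y).congr' ?_
      filter_upwards [eventually_ge_atTop (2 * y)] with x hx
      rw [indicator_of_mem (show y ∈ Iic (x / 2) from by simp only [mem_Iic]; linarith)]
  -- Squaring the tail at `x / 2` restores the full factor `e^{-αx}`, so the quotient is a constant
  -- times `x ^ (-1 - ρ)`.
  have hsq : Tendsto (fun x => F.real (Ioi (x / 2)) ^ 2 / F.real (Ioi x)) atTop (𝓝 0) := by
    have h1 : Tendsto (fun x : ℝ => x ^ (-1 - ρ)) atTop (𝓝 0) := by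
      have := tendsto_rpow_neg_atTop (show 0 < 1 + ρ by linarith [hρ.1])
      refine this.congr fun x => ?_
      ring_nf
    have h2 := h1.const_mul (c / temperedTail c α ρ x₀ * ((1 / 2 : ℝ) ^ (-1 - ρ)) ^ 2)
    rw [mul_zero] at h2
    refine h2.congr' ?_
    filter_upwards [eventually_ge_atTop (2 * x₀)] with x hx
    have hx0 : 0 < x := by linarith
    have hT := (temperedTail_pos (α := α) (ρ := ρ) hc hx₀).ne'
    have hxp := (Real.rpow_pos_of_pos hx0 (-1 - ρ)).ne'
    rw [htail (by linarith), htail (by linarith)]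
    have e1 : temperedTail c α ρ (x / 2) ^ 2 =
        c ^ 2 * Real.exp (-α * x) * ((1 / 2 : ℝ) ^ (-1 - ρ)) ^ 2 * (x ^ (-1 - ρ)) ^ 2 := by
      rw [temperedTail, show x / 2 = 1 / 2 * x by ring,
        Real.mul_rpow (by norm_num) hx0.le, show -α * x = -α * (1 / 2 * x) + -α * (1 / 2 * x) by ring,
        Real.exp_add]
      ring
    rw [div_pow, e1, temperedTail.eq_def c α ρ x]
    field_simp
  have := (hdom.const_mul 2).add hsq
  rw [add_zero] at this
  refine this.congr fun x => ?_
  have e : ∫ y, (Iic (x / 2)).indicator (fun y => F.real (Ioi (x - y)) / F.real (Ioi x)) y ∂F =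
      (∫ y, (Iic (x / 2)).indicator (fun y => F.real (Ioi (x - y))) y ∂F) / F.real (Ioi x) := by
    rw [← integral_div]
    refine integral_congr_ae (ae_of_all _ fun y => ?_)
    by_cases h : y ∈ Iic (x / 2)
    · simp only [indicator_of_mem h]
    · simp only [indicator_of_notMem h, zero_div]
  rw [conv_self_real_Ioi, add_div, mul_div_assoc, e]

/-! ### Uniqueness of the Lévy measure -/

/-- The integrand of the Lévy–Khintchine exponent. -/
def levyIntegrand (θ x : ℝ) : ℂ :=
  Complex.exp (Complex.I * θ * x) - 1 - Complex.I * θ * (if |x| < 1 then (x : ℂ) else 0)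

lemma measurable_levyIntegrand (θ : ℝ) : Measurable (levyIntegrand θ) := by
  have : Measurable fun x : ℝ => if |x| < 1 then (x : ℂ) else 0 :=
    Measurable.ite (measurableSet_lt (by fun_prop) measurable_const) Complex.measurable_ofReal
      measurable_const
  unfold levyIntegrand
  fun_prop

lemma continuous_levyIntegrand (x : ℝ) : Continuous fun θ => levyIntegrand θ x := by
  unfold levyIntegrand
  fun_prop

lemma norm_levyIntegrand_le (θ x : ℝ) :
    ‖levyIntegrand θ x‖ ≤ (3 * θ ^ 2 + 2) * min 1 (x ^ 2) := by
  have hexp : Complex.I * θ * x = Complex.I * (θ * x : ℝ) := by push_cast; ring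
  unfold levyIntegrand
  split_ifs with h
  · rw [min_eq_right ((sq_le_one_iff_abs_le_one x).mpr h.le), hexp]
    refine (norm_cexp_I_mul_sub_one_sub_le (θ * x)).trans ?_
    nlinarith [sq_nonneg x]
  · rw [min_eq_left (one_le_sq_iff_one_le_abs x |>.mpr (not_lt.mp h)), hexp, mul_zero, sub_zero]
    have h1 : ‖Complex.exp (Complex.I * (θ * x : ℝ))‖ = 1 := by
      rw [mul_comm]; exact Complex.norm_exp_ofReal_mul_I _
    calc _ ≤ ‖Complex.exp (Complex.I * (θ * x : ℝ))‖ + ‖(1 : ℂ)‖ := norm_sub_le _ _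
      _ ≤ _ := by rw [h1, norm_one]; nlinarith [sq_nonneg θ]

section

variable {ν : Measure ℝ}

lemma IsLevyMeasure.integrable_min (hν : IsLevyMeasure ν) :
    Integrable (fun x : ℝ => min 1 (x ^ 2)) ν := by
  refine ⟨by fun_prop, ?_⟩
  rw [hasFiniteIntegral_iff_ofReal (ae_of_all _ fun x => by positivity)]
  exact hν.integrable

lemma IsLevyMeasure.integrable_levyIntegrand (hν : IsLevyMeasure ν) (θ : ℝ) :
    Integrable (levyIntegrand θ) ν :=
  (hν.integrable_min.const_mul (3 * θ ^ 2 + 2)).mono'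
    (measurable_levyIntegrand θ).aestronglyMeasurable
    (ae_of_all _ fun x => norm_levyIntegrand_le θ x)

lemma levyKhintchineExponent_eq (γ s : ℝ) (ν : Measure ℝ) (θ : ℝ) :
    levyKhintchineExponent γ s ν θ =
      Complex.I * θ * γ - s * θ ^ 2 / 2 + ∫ x, levyIntegrand θ x ∂ν := rfl

lemma IsLevyMeasure.continuous_levyKhintchineExponent (hν : IsLevyMeasure ν) (γ s : ℝ) :
    Continuous (levyKhintchineExponent γ s ν) := by
  have hint : Continuous fun θ => ∫ x, levyIntegrand θ x ∂ν := by
    refine continuous_iff_continuousAt.mpr fun θ₀ => ?_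
    refine continuousAt_of_dominated (bound := fun x => (3 * (|θ₀| + 1) ^ 2 + 2) * min 1 (x ^ 2))
      (Eventually.of_forall fun θ => (measurable_levyIntegrand θ).aestronglyMeasurable) ?_
      (hν.integrable_min.const_mul _)
      (ae_of_all _ fun x => (continuous_levyIntegrand x).continuousAt)
    filter_upwards [Metric.ball_mem_nhds θ₀ one_pos] with θ hθ
    refine ae_of_all _ fun x => (norm_levyIntegrand_le θ x).trans ?_
    rw [Metric.mem_ball, Real.dist_eq] at hθ
    have h1 : |θ| ≤ |θ₀| + 1 := by
      have := abs_sub_abs_le_abs_sub θ θ₀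
      linarith
    have h2 : θ ^ 2 ≤ (|θ₀| + 1) ^ 2 := by
      rw [← sq_abs θ]
      gcongr
    gcongr
  simp only [funext (levyKhintchineExponent_eq γ s ν)]
  fun_prop

lemma levyKhintchineExponent_zero (γ s : ℝ) (ν : Measure ℝ) :
    levyKhintchineExponent γ s ν 0 = 0 := by
  simp [levyKhintchineExponent]

/-- Continuous logarithms that agree at one point are equal. -/
lemma eq_of_cexp_eq {f g : ℝ → ℂ} (hf : Continuous f) (hg : Continuous g)
    (h0 : f 0 = g 0) (h : ∀ x, Complex.exp (f x) = Complex.exp (g x)) : f = g := by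
  have hn : ∀ x, ∃ n : ℤ, f x = g x + n * (2 * Real.pi * Complex.I) := fun x =>
    Complex.exp_eq_exp_iff_exists_int.mp (h x)
  choose n hn using hn
  have hπ := Real.pi_pos
  have him : ∀ x, |(f x - g x).im / (2 * Real.pi)| = |(n x : ℝ)| := fun x => by
    rw [hn x]
    simp only [add_sub_cancel_left, Complex.mul_im, Complex.intCast_re, Complex.intCast_im]
    simp [hπ.ne']
  have hcont : Continuous fun x => |(f x - g x).im / (2 * Real.pi)| := by fun_prop
  ext x
  suffices n x = 0 by rw [hn x, this]; simp
  by_contra hx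
  have h1 : (1 : ℝ) ≤ |(n x : ℝ)| := by exact_mod_cast Int.one_le_abs hx
  -- The continuous function `|n|` is `0` at the origin and at least `1` at `x`, so it would take
  -- the value `1 / 2`, impossible for an integer.
  obtain ⟨y, hy⟩ := mem_range_of_exists_le_of_exists_ge hcont
    (c := 1 / 2) ⟨0, by simp [h0]⟩ ⟨x, by rw [him]; linarith⟩
  replace hy := (him y).symm.trans hy
  have h2 : |n y| * 2 = 1 := by
    have : (|n y| : ℝ) * 2 = 1 := by rw [hy]; norm_num
    exact_mod_cast this
  omega

/-- The characteristic function fixes the exponent only modulo `2πi`; continuity and the value `0`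
at `0` select the branch. -/
lemma HasLevyTriplet.exponent_unique {Ω : Type*} [MeasurableSpace Ω] {X : ℝ≥0 → Ω → ℝ}
    {P : Measure Ω} {γ s γ' s' : ℝ} {ν' : Measure ℝ} (h : HasLevyTriplet X P γ s ν)
    (h' : HasLevyTriplet X P γ' s' ν') :
    levyKhintchineExponent γ s ν = levyKhintchineExponent γ' s' ν' :=
  eq_of_cexp_eq (h.levyMeasure.continuous_levyKhintchineExponent γ s)
    (h'.levyMeasure.continuous_levyKhintchineExponent γ' s')
    (by rw [levyKhintchineExponent_zero, levyKhintchineExponent_zero])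
    fun θ => by rw [← h.charFun_eq, ← h'.charFun_eq]

/-- The weight of the second difference with step `h`. -/
def cosWeight (h x : ℝ) : ℝ := 2 * (1 - Real.cos (h * x))

lemma cosWeight_nonneg (h x : ℝ) : 0 ≤ cosWeight h x := by
  unfold cosWeight
  linarith [Real.cos_le_one (h * x)]

lemma measurable_cosWeight (h : ℝ) : Measurable (cosWeight h) := by
  unfold cosWeight
  fun_prop

lemma cosWeight_le (h x : ℝ) : cosWeight h x ≤ (4 + h ^ 2) * min 1 (x ^ 2) := by
  unfold cosWeight
  rcases min_choice 1 (x ^ 2) with hm | hm <;> rw [hm]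
  · nlinarith [Real.neg_one_le_cos (h * x), sq_nonneg h]
  · nlinarith [Real.one_sub_sq_div_two_le_cos (x := h * x), sq_nonneg x]

/-- The finite measure whose characteristic function is minus the second difference of the
Lévy–Khintchine exponent. -/
def secondDifferenceMeasure (s : ℝ) (ν : Measure ℝ) (h : ℝ) : Measure ℝ :=
  ν.withDensity (fun x => ENNReal.ofReal (cosWeight h x)) +
    ENNReal.ofReal (s * h ^ 2) • Measure.dirac 0

lemma IsLevyMeasure.isFiniteMeasure_withDensity (hν : IsLevyMeasure ν) (h : ℝ) :
    IsFiniteMeasure (ν.withDensity fun x => ENNReal.ofReal (cosWeight h x)) := by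
  refine MeasureTheory.isFiniteMeasure_withDensity (ne_of_lt ?_)
  exact lt_of_le_of_lt (lintegral_mono fun x => ENNReal.ofReal_le_ofReal (cosWeight_le h x))
    (hν.integrable_min.const_mul _).lintegral_lt_top

lemma IsLevyMeasure.isFiniteMeasure_secondDifferenceMeasure (hν : IsLevyMeasure ν) (s h : ℝ) :
    IsFiniteMeasure (secondDifferenceMeasure s ν h) := by
  have := hν.isFiniteMeasure_withDensity h
  have : IsFiniteMeasure (ENNReal.ofReal (s * h ^ 2) • (Measure.dirac 0 : Measure ℝ)) :=
    Measure.smul_finite _ ENNReal.ofReal_ne_top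
  unfold secondDifferenceMeasure
  infer_instance

/-- A second difference kills the drift and the compensator, which are linear in `θ`. The quadratic
Gaussian term becomes the constant `s h²`, an atom at `0`, and `2 - e^{ihx} - e^{-ihx}` is the
cosine weight. -/
lemma IsLevyMeasure.charFun_secondDifferenceMeasure (hν : IsLevyMeasure ν) {s : ℝ} (hs : 0 ≤ s)
    (γ h θ : ℝ) :
    charFun (secondDifferenceMeasure s ν h) θ =
      2 * levyKhintchineExponent γ s ν θ - levyKhintchineExponent γ s ν (θ + h) -
        levyKhintchineExponent γ s ν (θ - h) := by
  have hfin := hν.isFiniteMeasure_withDensity h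
  have hfin' : IsFiniteMeasure (ENNReal.ofReal (s * h ^ 2) • (Measure.dirac 0 : Measure ℝ)) :=
    Measure.smul_finite _ ENNReal.ofReal_ne_top
  have hm : Measurable fun x : ℝ => Complex.exp (θ * x * Complex.I) := by fun_prop
  have hbd : ∀ x : ℝ, ‖Complex.exp (θ * x * Complex.I)‖ ≤ 1 := fun x => by
    rw [← Complex.ofReal_mul, Complex.norm_exp_ofReal_mul_I]
  have hi : ∀ μ : Measure ℝ, IsFiniteMeasure μ →
      Integrable (fun x : ℝ => Complex.exp (θ * x * Complex.I)) μ := fun μ _ =>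
    (integrable_const (1 : ℝ)).mono' hm.aestronglyMeasurable (ae_of_all _ hbd)
  rw [charFun_apply_real, secondDifferenceMeasure, integral_add_measure (hi _ hfin) (hi _ hfin'),
    integral_smul_measure, integral_dirac,
    integral_withDensity_eq_integral_toReal_smul (measurable_cosWeight h).ennreal_ofReal
      (ae_of_all _ fun _ => ENNReal.ofReal_lt_top)]
  simp only [levyKhintchineExponent_eq, ENNReal.toReal_ofReal (cosWeight_nonneg _ _),
    ENNReal.toReal_ofReal (mul_nonneg hs (sq_nonneg h))]
  have key : ∫ x : ℝ, cosWeight h x • Complex.exp (θ * x * Complex.I) ∂ν =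
      2 * ∫ x, levyIntegrand θ x ∂ν - ∫ x, levyIntegrand (θ + h) x ∂ν -
        ∫ x, levyIntegrand (θ - h) x ∂ν := by
    have i1 := (hν.integrable_levyIntegrand θ).const_mul 2
    have i2 := hν.integrable_levyIntegrand (θ + h)
    have i3 := hν.integrable_levyIntegrand (θ - h)
    have i4 : Integrable (fun x => 2 * levyIntegrand θ x - levyIntegrand (θ + h) x) ν := i1.sub i2
    rw [← integral_const_mul, ← integral_sub i1 i2, ← integral_sub i4 i3]
    refine integral_congr_ae (ae_of_all _ fun x => ?_)
    have e1 : Complex.exp (Complex.I * θ * x) = Complex.exp (θ * x * Complex.I) := by ring_nf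
    have e2 : Complex.exp (Complex.I * (θ + h : ℝ) * x) =
        Complex.exp (θ * x * Complex.I) * Complex.exp ((h * x : ℂ) * Complex.I) := by
      rw [← Complex.exp_add]; push_cast; ring_nf
    have e3 : Complex.exp (Complex.I * (θ - h : ℝ) * x) =
        Complex.exp (θ * x * Complex.I) * Complex.exp (-(h * x : ℂ) * Complex.I) := by
      rw [← Complex.exp_add]; push_cast; ring_nf
    simp only [levyIntegrand, cosWeight, Complex.real_smul, e1, e2, e3]
    push_cast
    rw [Complex.cos]
    ring
  rw [key]
  simp
  ring

/-- The weight with step `h` vanishes on the lattice `(2π / h) ℤ`. Steps `1` and `√2` are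
incommensurable, so their lattices meet only at `0`. -/
lemma cosWeight_one_add_cosWeight_sqrt_two_pos {x : ℝ} (hx : x ≠ 0) :
    0 < cosWeight 1 x + cosWeight (Real.sqrt 2) x := by
  by_contra! hle
  have h1 : cosWeight 1 x = 0 := le_antisymm
    (by linarith [cosWeight_nonneg (Real.sqrt 2) x]) (cosWeight_nonneg _ _)
  have h2 : cosWeight (Real.sqrt 2) x = 0 := le_antisymm
    (by linarith [cosWeight_nonneg 1 x]) (cosWeight_nonneg _ _)
  have h1' : Real.cos (1 * x) = 1 := by unfold cosWeight at h1; linarith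
  have h2' : Real.cos (Real.sqrt 2 * x) = 1 := by unfold cosWeight at h2; linarith
  obtain ⟨m, hm⟩ := (Real.cos_eq_one_iff _).mp h1'
  obtain ⟨n, hn⟩ := (Real.cos_eq_one_iff _).mp h2'
  rw [one_mul] at hm
  have hπ := Real.pi_pos
  have hm0 : (m : ℝ) ≠ 0 := fun h => hx (by rw [← hm, h, zero_mul])
  refine irrational_sqrt_two ⟨n / m, ?_⟩
  push_cast
  rw [div_eq_iff hm0]
  rw [← hm] at hn
  have : (n : ℝ) * (2 * Real.pi) = (Real.sqrt 2 * m) * (2 * Real.pi) := by rw [hn]; ring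
  exact mul_right_cancel₀ (by positivity) this

/-- Removing the origin discards the Gaussian atom and loses none of `ν`; dividing by the weight,
positive off `0`, then recovers `ν`. -/
lemma IsLevyMeasure.withDensity_cosWeight_withDensity_inv (hν : IsLevyMeasure ν) (s : ℝ) :
    ((secondDifferenceMeasure s ν 1 + secondDifferenceMeasure s ν (Real.sqrt 2)).restrict
      {0}ᶜ).withDensity (fun x => (ENNReal.ofReal (cosWeight 1 x) +
        ENNReal.ofReal (cosWeight (Real.sqrt 2) x))⁻¹) = ν := by
  have h0 : ∀ᵐ x ∂ν, x ≠ 0 := by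
    rw [ae_iff]
    simpa using hν.zero
  have hres : ν.restrict {0}ᶜ = ν := Measure.restrict_eq_self_of_ae_mem h0
  have hm1 := (measurable_cosWeight 1).ennreal_ofReal
  have hm2 := (measurable_cosWeight (Real.sqrt 2)).ennreal_ofReal
  have hc : MeasurableSet ({0}ᶜ : Set ℝ) := (measurableSet_singleton 0).compl
  have hsd : ∀ h, (secondDifferenceMeasure s ν h).restrict {0}ᶜ =
      ν.withDensity fun x => ENNReal.ofReal (cosWeight h x) := fun h => by
    rw [secondDifferenceMeasure, Measure.restrict_add, Measure.restrict_smul,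
      restrict_withDensity hc, hres, Measure.restrict_eq_zero.mpr (show Measure.dirac (0 : ℝ) {0}ᶜ = 0
        by simp), smul_zero, add_zero]
  rw [Measure.restrict_add, hsd, hsd, ← withDensity_add_left hm1]
  refine withDensity_inv_same (hm1.add hm2) ?_ (ae_of_all _ fun x => by simp)
  filter_upwards [h0] with x hx
  have := cosWeight_one_add_cosWeight_sqrt_two_pos hx
  simp only [Pi.add_apply, ne_eq, add_eq_zero, ENNReal.ofReal_eq_zero, not_and_or, not_le]
  by_contra! hcon
  linarith [hcon.1, hcon.2]

/-- The Lévy measure of a Lévy process is determined by the law of `X 1`. -/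
lemma HasLevyTriplet.measure_unique {Ω : Type*} [MeasurableSpace Ω] {X : ℝ≥0 → Ω → ℝ}
    {P : Measure Ω} {γ s γ' s' : ℝ} {ν' : Measure ℝ} (h : HasLevyTriplet X P γ s ν)
    (h' : HasLevyTriplet X P γ' s' ν') : ν = ν' := by
  have hexp := h.exponent_unique h'
  have hsd : ∀ t, secondDifferenceMeasure s ν t = secondDifferenceMeasure s' ν' t := fun t => by
    have := h.levyMeasure.isFiniteMeasure_secondDifferenceMeasure s t
    have := h'.levyMeasure.isFiniteMeasure_secondDifferenceMeasure s' t
    refine Measure.ext_of_charFun (funext fun θ => ?_)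
    rw [h.levyMeasure.charFun_secondDifferenceMeasure h.nonneg γ,
      h'.levyMeasure.charFun_secondDifferenceMeasure h'.nonneg γ', hexp]
  rw [← h.levyMeasure.withDensity_cosWeight_withDensity_inv s,
    ← h'.levyMeasure.withDensity_cosWeight_withDensity_inv s', hsd, hsd]

end

/-! ### Moment generating functions at the end of their domain -/

section mgf

variable {Ω : Type*} [MeasurableSpace Ω] {P : Measure Ω} {Y : Ω → ℝ}

/-- If the moment generating function stays bounded as its argument increases to `α`, then it is
finite at `α`. -/
lemma integrable_exp_mul_of_tendsto_mgf (hY : Measurable Y) {α L : ℝ}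
    (hint : ∀ θ < α, Integrable (fun ω => Real.exp (θ * Y ω)) P)
    (hL : Tendsto (mgf Y P) (𝓝[<] α) (𝓝 L)) : Integrable (fun ω => Real.exp (α * Y ω)) P := by
  obtain ⟨θ, -, hθlt, hθ⟩ := exists_seq_strictMono_tendsto' (show α - 1 < α by linarith)
  have hθα : ∀ n, θ n < α := fun n => (hθlt n).2
  have hθ' : Tendsto θ atTop (𝓝[<] α) :=
    tendsto_nhdsWithin_iff.mpr ⟨hθ, Eventually.of_forall hθα⟩
  refine ⟨by fun_prop, ?_⟩
  rw [hasFiniteIntegral_iff_ofReal (ae_of_all _ fun ω => (Real.exp_pos _).le)]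
  have hpt : ∀ ω, Tendsto (fun n => ENNReal.ofReal (Real.exp (θ n * Y ω))) atTop
      (𝓝 (ENNReal.ofReal (Real.exp (α * Y ω)))) := fun ω =>
    ENNReal.tendsto_ofReal ((Real.continuous_exp.tendsto _).comp (hθ.mul_const _))
  have hmgf : ∀ n, ∫⁻ ω, ENNReal.ofReal (Real.exp (θ n * Y ω)) ∂P =
      ENNReal.ofReal (mgf Y P (θ n)) := fun n =>
    (ofReal_integral_eq_lintegral_ofReal (hint _ (hθα n))
      (ae_of_all _ fun ω => (Real.exp_pos _).le)).symm
  -- Fatou's lemma along a sequence increasing to `α`.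
  calc ∫⁻ ω, ENNReal.ofReal (Real.exp (α * Y ω)) ∂P
      = ∫⁻ ω, liminf (fun n => ENNReal.ofReal (Real.exp (θ n * Y ω))) atTop ∂P :=
        lintegral_congr fun ω => (hpt ω).liminf_eq.symm
    _ ≤ liminf (fun n => ∫⁻ ω, ENNReal.ofReal (Real.exp (θ n * Y ω)) ∂P) atTop :=
        lintegral_liminf_le fun n => by fun_prop
    _ = ENNReal.ofReal L := by
        simp_rw [hmgf]
        exact (ENNReal.tendsto_ofReal (hL.comp hθ')).liminf_eq
    _ < ⊤ := ENNReal.ofReal_lt_top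

/-- Left continuity of the moment generating function at a positive point where it is finite. -/
lemma tendsto_mgf_nhdsLT [IsFiniteMeasure P] (hY : Measurable Y) {α : ℝ} (hα : 0 < α)
    (hint : Integrable (fun ω => Real.exp (α * Y ω)) P) :
    Tendsto (mgf Y P) (𝓝[<] α) (𝓝 (mgf Y P α)) := by
  -- For `0 < θ < α`, `e^{θY}` is at most `e^{αY}` where `Y ≥ 0` and at most `1` where `Y ≤ 0`.
  refine tendsto_integral_filter_of_dominated_convergence (fun ω => 1 + Real.exp (α * Y ω))
    (Eventually.of_forall fun θ => by fun_prop) ?_ ((integrable_const 1).add hint) ?_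
  · filter_upwards [Ioo_mem_nhdsLT hα] with θ hθ
    refine ae_of_all _ fun ω => ?_
    rw [Real.norm_of_nonneg (Real.exp_pos _).le]
    rcases le_total 0 (Y ω) with h | h
    · have : Real.exp (θ * Y ω) ≤ Real.exp (α * Y ω) :=
        Real.exp_le_exp.mpr (mul_le_mul_of_nonneg_right hθ.2.le h)
      linarith
    · have : Real.exp (θ * Y ω) ≤ 1 :=
        Real.exp_le_one_iff.mpr (mul_nonpos_of_nonneg_of_nonpos hθ.1.le h)
      linarith [Real.exp_pos (α * Y ω)]
  · refine ae_of_all _ fun ω => ?_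
    have : Continuous fun θ : ℝ => Real.exp (θ * Y ω) := by fun_prop
    exact (this.tendsto α).mono_left nhdsWithin_le_nhds

/-- The convexity bound for the increments of the moment generating function. -/
lemma mgf_sub_mgf_le {α θ : ℝ} (hα : Integrable (fun ω => Real.exp (α * Y ω)) P)
    (hθ : Integrable (fun ω => Real.exp (θ * Y ω)) P)
    (h : Integrable (fun ω => Y ω * Real.exp (α * Y ω)) P) :
    mgf Y P α - mgf Y P θ ≤ (α - θ) * ∫ ω, Y ω * Real.exp (α * Y ω) ∂P := by
  rw [mgf, mgf, ← integral_sub hα hθ, ← integral_const_mul]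
  refine integral_mono (hα.sub hθ) (h.const_mul _) fun ω => ?_
  have h1 := Real.add_one_le_exp ((θ - α) * Y ω)
  have h2 : Real.exp (θ * Y ω) = Real.exp (α * Y ω) * Real.exp ((θ - α) * Y ω) := by
    rw [← Real.exp_add]; ring_nf
  simp only [h2]
  nlinarith [Real.exp_pos (α * Y ω)]

end mgf

/-! ### The slope near `α` for `0 < ρ < 1` -/

lemma gtscSlope_sub_gtscSlope_self {q d c α ρ : ℝ} (hρ : ρ ∈ Ioo (0 : ℝ) 1) (θ : ℝ) :
    gtscSlope q d c α ρ θ =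
      gtscSlope q d c α ρ α - d * (α - θ) + c * Real.Gamma (-ρ) * (α - θ) ^ ρ := by
  rw [gtscSlope_self hρ, gtscSlope, if_neg hρ.1.ne']
  ring

lemma gtscSlope_le {q d c α ρ : ℝ} (hd : 0 ≤ d) (hρ : ρ ∈ Ioo (0 : ℝ) 1) {θ : ℝ} (hθ : θ ≤ α) :
    gtscSlope q d c α ρ θ ≤
      gtscSlope q d c α ρ α + c * Real.Gamma (-ρ) * (α - θ) ^ ρ := by
  rw [gtscSlope_sub_gtscSlope_self hρ θ]
  nlinarith [mul_nonneg hd (sub_nonneg.mpr hθ)]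

lemma gtscSlope_lt_self {q d c α ρ : ℝ} (hd : 0 ≤ d) (hc : 0 < c) (hρ : ρ ∈ Ioo (0 : ℝ) 1)
    {θ : ℝ} (hθ : θ < α) : gtscSlope q d c α ρ θ < gtscSlope q d c α ρ α := by
  have h1 := gtscSlope_le (q := q) (c := c) hd hρ hθ.le
  have h2 := mul_neg_of_neg_of_pos (mul_neg_of_pos_of_neg hc (Gamma_neg_lt_zero hρ))
    (Real.rpow_pos_of_pos (sub_pos.mpr hθ) ρ)
  linarith

/-- A power `t ^ ρ` with `ρ < 1` is not bounded by a multiple of `t` near `0`, even after the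
transformation `u ↦ 1 - e^{-u}`. -/
lemma not_eventually_one_sub_exp_neg_rpow_le {a ρ : ℝ} (ha : 0 < a) (hρ : ρ ∈ Ioo (0 : ℝ) 1)
    (M : ℝ) : ¬ ∀ᶠ t : ℝ in 𝓝[>] 0, 1 - Real.exp (-(a * t ^ ρ)) ≤ t * M := by
  intro h
  have hρ1 : 0 < 1 - ρ := by linarith [hρ.2]
  have hlim : Tendsto (fun t : ℝ => t ^ (1 - ρ) * (M * (1 + a * t ^ ρ))) (𝓝[>] 0) (𝓝 0) := by
    have hc : Continuous fun t : ℝ => t ^ (1 - ρ) * (M * (1 + a * t ^ ρ)) :=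
      (Real.continuous_rpow_const hρ1.le).mul (continuous_const.mul
        (continuous_const.add (continuous_const.mul (Real.continuous_rpow_const hρ.1.le))))
    have := hc.tendsto 0
    rw [Real.zero_rpow hρ1.ne', zero_mul] at this
    exact this.mono_left nhdsWithin_le_nhds
  refine absurd (ge_of_tendsto hlim ?_) (not_le.mpr ha)
  filter_upwards [h, self_mem_nhdsWithin] with t ht ht0
  have ht0 : 0 < t := ht0
  have hp : 0 < t ^ ρ := Real.rpow_pos_of_pos ht0 ρ
  set u := a * t ^ ρ with hu
  have hu0 : 0 < u := mul_pos ha hp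
  -- This is `1 - e^{-u} ≥ u / (1 + u)`. Combined with the assumed bound and divided by `t ^ ρ`, it
  -- bounds `a` by a quantity tending to `0`.
  have h1 : Real.exp (-u) * (1 + u) ≤ 1 := by
    have h2 := Real.add_one_le_exp u
    have h3 : Real.exp (-u) * Real.exp u = 1 := by rw [← Real.exp_add]; simp
    nlinarith [Real.exp_pos (-u)]
  have h2 : u ≤ t * M * (1 + u) := by nlinarith
  have h3 : t = t ^ (1 - ρ) * t ^ ρ := by rw [← Real.rpow_add ht0]; simp
  have h4 : a * t ^ ρ ≤ t ^ (1 - ρ) * (M * (1 + u)) * t ^ ρ := by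
    calc a * t ^ ρ ≤ t * M * (1 + u) := h2
      _ = t ^ (1 - ρ) * t ^ ρ * M * (1 + u) := by rw [← h3]
      _ = _ := by ring
  exact le_of_mul_le_mul_right h4 hp

/-! ### Classification of GTSC processes -/

section IsGTSC

variable {Ω : Type*} [MeasurableSpace Ω] {P : Measure Ω} {X : ℝ≥0 → Ω → ℝ} {q d c α ρ : ℝ}

lemma IsGTSC.cgf_eq_mul (hX : IsGTSC X P q d c α ρ) {θ : ℝ} (hθ : θ < α) :
    cgf (X 1) P θ = θ * gtscSlope q d c α ρ θ := by
  rw [hX.cgf_eq θ hθ, gtscExponent_eq_mul_gtscSlope]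

lemma IsGTSC.mgf_eq (hX : IsGTSC X P q d c α ρ) {θ : ℝ} (hθ : θ < α) :
    mgf (X 1) P θ = Real.exp (θ * gtscSlope q d c α ρ θ) := by
  have := hX.levy.isProbabilityMeasure
  rw [← hX.cgf_eq_mul hθ, exp_cgf (hX.integrable_exp θ hθ)]

lemma IsGTSC.tendsto_mgf (hX : IsGTSC X P q d c α ρ) (hρ : ρ ∈ Ioo (0 : ℝ) 1) :
    Tendsto (mgf (X 1) P) (𝓝[<] α) (𝓝 (Real.exp (α * gtscSlope q d c α ρ α))) := by
  have hcont : Continuous fun θ => Real.exp (θ * gtscSlope q d c α ρ θ) :=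
    Real.continuous_exp.comp (continuous_id.mul (gtscSlope_continuous hρ))
  refine ((hcont.tendsto α).mono_left nhdsWithin_le_nhds).congr' ?_
  filter_upwards [self_mem_nhdsWithin] with θ hθ using (hX.mgf_eq hθ).symm

lemma IsGTSC.integrable_exp_self (hX : IsGTSC X P q d c α ρ) (hρ : ρ ∈ Ioo (0 : ℝ) 1) :
    Integrable (fun ω => Real.exp (α * X 1 ω)) P :=
  integrable_exp_mul_of_tendsto_mgf (hX.levy.measurable 1) hX.integrable_exp (hX.tendsto_mgf hρ)

lemma IsGTSC.mgf_self (hX : IsGTSC X P q d c α ρ) (hα : 0 < α) (hρ : ρ ∈ Ioo (0 : ℝ) 1) :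
    mgf (X 1) P α = Real.exp (α * gtscSlope q d c α ρ α) := by
  have := hX.levy.isProbabilityMeasure
  exact tendsto_nhds_unique (tendsto_mgf_nhdsLT (hX.levy.measurable 1) hα
    (hX.integrable_exp_self hρ)) (hX.tendsto_mgf hρ)

/-- On `Re z < α` the number `α - z` avoids the branch cut, so both sides are analytic there; they
agree for real arguments. -/
lemma IsGTSC.complexMGF_eq (hX : IsGTSC X P q d c α ρ) (hρ : ρ ∈ Ioo (0 : ℝ) 1) {z : ℂ}
    (hz : z.re < α) :
    complexMGF (X 1) P z = Complex.exp (-q * z + d * z ^ 2 - c * z * Real.Gamma (-ρ) *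
      ((α : ℂ) ^ (ρ : ℂ) - (α - z) ^ (ρ : ℂ))) := by
  have hg : AnalyticOnNhd ℂ (fun z : ℂ => Complex.exp (-q * z + d * z ^ 2 -
      c * z * Real.Gamma (-ρ) * ((α : ℂ) ^ (ρ : ℂ) - (α - z) ^ (ρ : ℂ)))) {z | z.re < α} := by
    intro w hw
    have hw' : (α : ℂ) - w ∈ Complex.slitPlane := Or.inl (by simpa using hw)
    have h1 : AnalyticAt ℂ (fun z : ℂ => ((α : ℂ) - z) ^ (ρ : ℂ)) w :=
      (analyticAt_const.sub analyticAt_id).cpow analyticAt_const hw'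
    fun_prop
  refine (analyticOnNhd_complexMGF_re_lt hX.integrable_exp).eqOn_re_lt_of_eqOn_real hg
    (fun x hx => ?_) hz
  rw [complexMGF_ofReal, hX.mgf_eq hx, ← gtscExponent_eq_mul_gtscSlope, gtscExponent,
    if_neg hρ.1.ne', ← Complex.ofReal_sub, ← Complex.ofReal_cpow hX.alpha_nonneg,
    ← Complex.ofReal_cpow (sub_pos.mpr hx).le]
  push_cast
  rfl

/-- Since `α > 0`, the imaginary axis lies in the half-plane of `IsGTSC.complexMGF_eq`, and there
the formula is the computed Lévy–Khintchine exponent. -/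
lemma IsGTSC.hasLevyTriplet (hX : IsGTSC X P q d c α ρ) (hα : 0 < α) (hρ : ρ ∈ Ioo (0 : ℝ) 1) :
    HasLevyTriplet X P (-q - temperedBigJumpMean c α ρ) (2 * d) (temperedMeasure c α ρ) where
  nonneg := mul_nonneg zero_le_two hX.d_nonneg
  levyMeasure := isLevyMeasure_temperedMeasure hα hX.c_pos hρ
  charFun_eq θ := by
    rw [levyKhintchineExponent_temperedMeasure hα hX.c_pos hρ,
      ← hX.complexMGF_eq hρ (by simpa using hα), complexMGF]
    simp_rw [mul_comm Complex.I (θ : ℂ)]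

lemma IsGTSC.inCramerCase (hX : IsGTSC X P q d c α ρ) {ν₀ : ℝ} (hν : ν₀ ∈ Ioo 0 α)
    (h0 : gtscSlope q d c α ρ ν₀ = 0) : InCramerCase X P ν₀ where
  pos := hν.1
  integrable_exp := hX.integrable_exp ν₀ hν.2
  expectation_eq_one := by
    have := hX.mgf_eq hν.2
    rwa [h0, mul_zero, Real.exp_zero] at this
  integrable_mul_exp := by
    simpa using integrable_pow_mul_exp_of_mem_interior_integrableExpSet
      (Iio_subset_interior_integrableExpSet hX.integrable_exp hν.2) 1

lemma IsGTSC.inConvolutionEquivalentCase (hX : IsGTSC X P q d c α ρ) (hα : 0 < α)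
    (hρ : ρ ∈ Ioo (0 : ℝ) 1) (h : gtscSlope q d c α ρ α < 0) :
    InConvolutionEquivalentCase X P α where
  pos := hα
  tail := by
    have hpos : 0 < temperedMeasure c α ρ (Ioi 1) := by
      rw [temperedMeasure_Ioi hα hX.c_pos hρ one_pos]
      simpa using temperedTail_pos hX.c_pos one_pos
    exact ⟨_, _, _, hX.hasLevyTriplet hα hρ,
      hpos.trans_le (measure_mono (Ioi_subset_Ioi zero_le_one)), 1, one_pos, hpos,
      isConvolutionEquivalent_cond_temperedMeasure hα hX.c_pos hρ one_pos⟩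
  integrable_exp := hX.integrable_exp_self hρ
  expectation_lt_one := by
    have := hX.mgf_self hα hρ
    rw [mgf] at this
    rw [this]
    exact Real.exp_lt_one_iff.mpr (mul_neg_of_pos_of_neg hα h)

/-- The right end of the domain of the Laplace exponent is a vertical tangent point. -/
lemma IsGTSC.not_integrable_mul_exp_self (hX : IsGTSC X P q d c α ρ) (hα : 0 < α)
    (hρ : ρ ∈ Ioo (0 : ℝ) 1) (h0 : gtscSlope q d c α ρ α = 0) :
    ¬ Integrable (fun ω => X 1 ω * Real.exp (α * X 1 ω)) P := by
  intro h
  have hG : 0 < -(c * Real.Gamma (-ρ)) :=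
    neg_pos.mpr (mul_neg_of_pos_of_neg hX.c_pos (Gamma_neg_lt_zero hρ))
  -- Taking `t < α / 2` keeps `θ = α - t` above `α / 2`, whence the factor `α / 2` in the constant.
  refine not_eventually_one_sub_exp_neg_rpow_le (a := α / 2 * -(c * Real.Gamma (-ρ)))
    (by positivity) hρ (∫ ω, X 1 ω * Real.exp (α * X 1 ω) ∂P) ?_
  filter_upwards [Ioo_mem_nhdsGT (half_pos hα)] with t ht
  have hθ : α - t < α := by linarith [ht.1]
  have h1 := mgf_sub_mgf_le (hX.integrable_exp_self hρ) (hX.integrable_exp _ hθ) h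
  rw [hX.mgf_self hα hρ, h0, mul_zero, Real.exp_zero, hX.mgf_eq hθ, sub_sub_cancel] at h1
  refine le_trans (sub_le_sub_left (Real.exp_le_exp.mpr ?_) 1) h1
  have h2 := gtscSlope_le (q := q) (c := c) hX.d_nonneg hρ hθ.le
  rw [h0, sub_sub_cancel, zero_add] at h2
  have hp := Real.rpow_pos_of_pos ht.1 ρ
  have h3 : α / 2 ≤ α - t := by linarith [ht.2]
  calc (α - t) * gtscSlope q d c α ρ (α - t)
      ≤ (α - t) * (c * Real.Gamma (-ρ) * t ^ ρ) := by gcongr; linarith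
    _ ≤ -(α / 2 * -(c * Real.Gamma (-ρ)) * t ^ ρ) := by
      nlinarith [mul_le_mul_of_nonneg_right h3 (mul_pos hG hp).le]

/-- Below `α` the slope is negative, so the expectation is below `1`. At `α` the weighted mean is
infinite. A parameter above `α` would put `α` inside the domain of the moment generating function
and make that mean finite. -/
lemma IsGTSC.not_inCramerCase (hX : IsGTSC X P q d c α ρ) (hα : 0 < α)
    (hρ : ρ ∈ Ioo (0 : ℝ) 1) (h0 : gtscSlope q d c α ρ α = 0) (ν₀ : ℝ) :
    ¬ InCramerCase X P ν₀ := by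
  intro h
  have hnot := hX.not_integrable_mul_exp_self hα hρ h0
  rcases lt_trichotomy ν₀ α with hlt | rfl | hgt
  · have hlt0 := gtscSlope_lt_self (q := q) hX.d_nonneg hX.c_pos hρ hlt
    rw [h0] at hlt0
    have h1 := hX.mgf_eq hlt
    rw [mgf, h.expectation_eq_one] at h1
    exact absurd h1.symm (Real.exp_lt_one_iff.mpr (mul_neg_of_pos_of_neg h.pos hlt0)).ne
  · exact hnot h.integrable_mul_exp
  · have hint : ∀ θ < ν₀, Integrable (fun ω => Real.exp (θ * X 1 ω)) P := fun θ hθ =>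
      integrable_exp_mul_of_le_of_le (hX.integrable_exp (min θ (α - 1))
        (lt_of_le_of_lt (min_le_right _ _) (by linarith))) h.integrable_exp (min_le_left _ _) hθ.le
    refine hnot ?_
    simpa using integrable_pow_mul_exp_of_mem_interior_integrableExpSet
      (Iio_subset_interior_integrableExpSet hint hgt) 1

/-- By uniqueness of the Lévy measure, the tail ratio at shift `1` has both limits `e^{α'}` and
`e^α`. -/
lemma IsGTSC.index_eq_of_inConvolutionEquivalentCase (hX : IsGTSC X P q d c α ρ) (hα : 0 < α)
    (hρ : ρ ∈ Ioo (0 : ℝ) 1) {α' : ℝ} (h : InConvolutionEquivalentCase X P α') : α' = α := by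
  obtain ⟨γ, s, ν, hν, -, x₀, hx₀, -, hconv⟩ := h.tail
  rw [hν.measure_unique (hX.hasLevyTriplet hα hρ)] at hconv
  have := tendsto_nhds_unique (hconv.longTailed.tendsto 1)
    (tendsto_cond_temperedMeasure_tail_ratio hα hX.c_pos hρ hx₀ 1)
  simpa using this

lemma IsGTSC.not_inConvolutionEquivalentCase (hX : IsGTSC X P q d c α ρ) (hα : 0 < α)
    (hρ : ρ ∈ Ioo (0 : ℝ) 1) (h0 : gtscSlope q d c α ρ α = 0) (α' : ℝ) :
    ¬ InConvolutionEquivalentCase X P α' := by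
  intro h
  obtain rfl := hX.index_eq_of_inConvolutionEquivalentCase hα hρ h
  have h1 := hX.mgf_self hα hρ
  rw [h0, mul_zero, Real.exp_zero, mgf] at h1
  exact h.expectation_lt_one.ne h1

end IsGTSC

end

/-- Classification of the GTSC class into the Cramér case, the convolution equivalent case, and
neither. -/
theorem mainTheorem2 {Ω : Type*} [MeasurableSpace Ω] (P : Measure Ω) (X : ℝ≥0 → Ω → ℝ)
    (q d c α ρ : ℝ) (hα : 0 < α) (hX : IsGTSC X P q d c α ρ) :
    ((ρ ∈ Icc (-1 : ℝ) 0 ∨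
        (ρ ∈ Ioo (0 : ℝ) 1 ∧ 0 < d * α - q - c * α ^ ρ * Real.Gamma (-ρ))) →
      ∃ ν₀ ∈ Ioo 0 α,
        (∀ ν ∈ Ioo 0 α, cgf (X 1) P ν = 0 ↔ ν = ν₀) ∧
        (ρ ≠ 0 → d * ν₀ - q - c * Real.Gamma (-ρ) * (α ^ ρ - (α - ν₀) ^ ρ) = 0) ∧
        (ρ = 0 → d * ν₀ - q + c * Real.log (α / (α - ν₀)) = 0) ∧
        InCramerCase X P ν₀) ∧
    (ρ ∈ Ioo (0 : ℝ) 1 → d * α - q - c * α ^ ρ * Real.Gamma (-ρ) < 0 →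
      InConvolutionEquivalentCase X P α) ∧
    (ρ ∈ Ioo (0 : ℝ) 1 → d * α - q - c * α ^ ρ * Real.Gamma (-ρ) = 0 →
      (¬ ∃ ν₀ : ℝ, InCramerCase X P ν₀) ∧
      (¬ ∃ α' : ℝ, InConvolutionEquivalentCase X P α')) := by
  refine ⟨fun h => ?_, fun hρ h => ?_, fun hρ h => ?_⟩
  · obtain ⟨ν₀, hν₀, h0⟩ := exists_gtscSlope_eq_zero hα hX.q_pos
      (gtscSlope_eventually_pos (q := q) (d := d) hα hX.c_pos h)
    have hinj := (gtscSlope_strictMonoOn (q := q) hα hX.d_nonneg hX.c_pos hX.rho_mem).injOn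
    refine ⟨ν₀, hν₀, fun ν hν => ?_, fun hρ => ?_, fun hρ => ?_, hX.inCramerCase hν₀ h0⟩
    · rw [hX.cgf_eq_mul hν.2, mul_eq_zero, or_iff_right hν.1.ne', ← h0]
      exact hinj.eq_iff hν.2 hν₀.2
    · rwa [gtscSlope, if_neg hρ] at h0
    · rwa [gtscSlope, if_pos hρ] at h0
  · rw [← gtscSlope_self hρ] at h
    exact hX.inConvolutionEquivalentCase hα hρ h
  · rw [← gtscSlope_self hρ] at h
    exact ⟨fun ⟨ν₀, hν₀⟩ => hX.not_inCramerCase hα hρ h ν₀ hν₀,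
      fun ⟨α', hα'⟩ => hX.not_inConvolutionEquivalentCase hα hρ h α' hα'⟩
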